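/- Let $(\Omega,\mathcal F,\mathbb P)$ be an atomless probability space, $\mathcal L_1$ the set of random variables with values in $[0,1]$ and $\mathcal L^\infty$ the set of bounded random variables. A risk measure is a mapping $\rho:\mathcal L^\infty\to\mathbb R$ with $\rho(X)\le\rho(Y)$ whenever $X\le Y$. For $n\ge 2$, a rating criterion is a mapping $\mathcal I:\mathcal L_1\to\{1,\dots,n\}$ with $\mathcal I(X)\le\mathcal I(Y)$ whenever $X\le Y$. Let $S=(S_1,\dots,S_s)$, $s\ge1$, be a partition of $\Omega$ into events of positive probability, and let $\mathbb P_j=\mathbb P(\cdot\mid S_j)$. For a probability measure $Q$, write $X\le^Q_{\rm icx}Y$ if $\mathbb E^Q[\phi(X)]\le\mathbb E^Q[\phi(Y)]$ for every increasing (in the non-strict sense) convex function $\phi:\mathbb R\to\mathbb R$. A sequence of random variables is conditionally iid under $Q$ if, under $Q$, it is conditionally independent and identically distributed given some finite-dimensional random vector. For a sequence $L_1,L_2,\dots$ put $L^{(\ell)}=(L_1+\dots+L_\ell)/\ell$, $\ell\ge1$. Let $\Phi$ be a risk measure, with domain $\mathcal D=\mathcal L^\infty$, or a rating criterion, with domain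 $\mathcal D=\mathcal L_1$. Consider the following properties. - [LI]: $\Phi(X)=\Phi(Y)$ for all $X,Y\in\mathcal D$ with the same distribution under $\mathbb P$. [S-LI]: $\Phi(X)=\Phi(Y)$ for all $X,Y\in\mathcal D$ with the same distribution under $\mathbb P_j$ for each $j$. - [RA]: $\Phi(X)\le\Phi(Y)$ for all $X,Y\in\mathcal D$ with $X\le^{\mathbb P}_{\rm icx}Y$. [S-RA]: $\Phi(X)\le\Phi(Y)$ for all $X,Y\in\mathcal D$ with $X\le^{\mathbb P_j}_{\rm icx}Y$ for each $j$. - [PE]: for every sequence $(L_i)$ in $\mathcal L_1$ that is conditionally iid under $\mathbb P$, all $1\le\ell\le\ell'$ and all $K\in[0,1)$, $\Phi\big((L^{(\ell)}-K)_+/(1-K)\big)\ge\Phi\big((L^{(\ell')}-K)_+/(1-K)\big)$. [S-PE]: the same inequality for every sequence in $\mathcal L_1$ that is conditionally iid under each $\mathbb P_j$. [PE*] and [S-PE*]: as [PE] and [S-PE], but only for $K=0$. - [QC]: $\Phi(\lambda X+(1-\lambda)Y)\le\max\{\Phi(X),\Phi(Y)\}$ for all $X,Y\in\mathcal D$ and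 $\lambda\in[0,1]$. - [LS*]: $\liminf_{\ell\to\infty}\Phi(X_\ell)\ge\Phi(X)$ for all $X,X_1,X_2,\dots\in\mathcal D$ with $X_\ell\to X$ in the norm of $L^\infty(\mathbb P)$. Then, for every risk measure $\Phi$ and for every rating criterion $\Phi$: (i) [LI] $\Rightarrow$ [S-LI], [RA] $\Rightarrow$ [S-RA], [PE] $\Rightarrow$ [S-PE] and [PE*] $\Rightarrow$ [S-PE*]; if $S$ consists of the single scenario $\Omega$, these four implications are equivalences. (ii) [RA] implies both [LI] and [PE]. (iii) [S-RA] implies both [S-LI] and [S-PE]. (iv) [QC], [LS*] and [LI] together imply [RA]. (v) [QC], [LS*] and [S-LI] together imply [S-RA]. (vi) [QC] and [LI] together imply [PE*]. (vii) [QC] and [S-LI] together imply [S-PE*]. -/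

import Mathlib

open MeasureTheory ProbabilityTheory Filter Topology

noncomputable section

namespace RiskConsistency

variable {Ω : Type*} [MeasurableSpace Ω]

/-- Atomlessness of a measure on an arbitrary measurable space: every measurable set of positive
measure has a measurable subset of strictly smaller positive measure. -/
def Atomless (P : Measure Ω) : Prop :=
  ∀ A, MeasurableSet A → 0 < P A → ∃ B, B ⊆ A ∧ MeasurableSet B ∧ 0 < P B ∧ P B < P A

variable (Ω) in
/-- The random variables with values in `[0, 1]`. -/
def LOne : Set (Ω → ℝ) := {X | Measurable X ∧ ∀ ω, 0 ≤ X ω ∧ X ω ≤ 1}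

variable (Ω) in
/-- The bounded random variables. -/
def LInf : Set (Ω → ℝ) := {X | Measurable X ∧ ∃ C : ℝ, ∀ ω, |X ω| ≤ C}

variable (Ω) in
/-- A risk measure: a mapping from the bounded random variables to `ℝ` that is monotone for the
pointwise order. -/
structure RiskMeasure where
  toFun : LInf Ω → ℝ
  mono : Monotone toFun

variable (Ω) in
/-- A rating criterion with the categories `1, …, n`: a mapping from the `[0, 1]`-valued random
variables to `{1, …, n}` that is monotone for the pointwise order. -/
structure RatingCriterion (n : ℕ) where
  toFun : LOne Ω → ℕ
  one_le : ∀ X, 1 ≤ toFun X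
  le_card : ∀ X, toFun X ≤ n
  mono : Monotone toFun

/-- The ratings read as real numbers, so that the properties below apply to them. -/
def RatingCriterion.toReal {n : ℕ} (I : RatingCriterion Ω n) : LOne Ω → ℝ :=
  fun X => (I.toFun X : ℝ)

/-- A collection of scenarios: a finite partition of `Ω` into `s` events of positive
probability. -/
structure Scenarios (P : Measure Ω) (s : ℕ) where
  event : Fin s → Set Ω
  pos : 0 < s
  measurable : ∀ j, MeasurableSet (event j)
  disjoint : Pairwise fun i j => Disjoint (event i) (event j)
  prob_pos : ∀ j, 0 < P (event j)
  cover : ⋃ j, event j = Set.univ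

/-- The conditional probability measure given the scenario `j`. -/
def Scenarios.prob {P : Measure Ω} {s : ℕ} (S : Scenarios P s) (j : Fin s) : Measure Ω :=
  ProbabilityTheory.cond P (S.event j)

/-- The collection consists of the single scenario `Ω`. -/
def Scenarios.IsWhole {P : Measure Ω} {s : ℕ} (S : Scenarios P s) : Prop :=
  s = 1 ∧ ∀ j, S.event j = Set.univ

/-- `X ≤ Y` in increasing convex order under `Q`. -/
def IcxLE (Q : Measure Ω) (X Y : Ω → ℝ) : Prop :=
  ∀ φ : ℝ → ℝ, Monotone φ → ConvexOn ℝ Set.univ φ → ∫ ω, φ (X ω) ∂Q ≤ ∫ ω, φ (Y ω) ∂Q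

/-- Conditional probability of `A` given the random vector `Z`, as a random variable. -/
def condProb (Q : Measure Ω) {d : ℕ} (Z : Ω → Fin d → ℝ) (A : Set Ω) : Ω → ℝ :=
  condExp (MeasurableSpace.comap Z inferInstance) Q (A.indicator fun _ => (1 : ℝ))

/-- Under `Q`, the sequence `L` is conditionally independent and identically distributed given
some random vector `Z`. -/
def CondIID (Q : Measure Ω) (L : ℕ → Ω → ℝ) : Prop :=
  ∃ (d : ℕ) (Z : Ω → Fin d → ℝ), Measurable Z ∧
    (∀ (t : Finset ℕ) (B : ℕ → Set ℝ), (∀ i, MeasurableSet (B i)) →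
      condProb Q Z (⋂ i ∈ t, L i ⁻¹' B i) =ᵐ[Q] fun ω => ∏ i ∈ t, condProb Q Z (L i ⁻¹' B i) ω) ∧
    (∀ (i k : ℕ) (B : Set ℝ), MeasurableSet B →
      condProb Q Z (L i ⁻¹' B) =ᵐ[Q] condProb Q Z (L k ⁻¹' B))

/-- The average of the first `l` members of the sequence. -/
def pool (L : ℕ → Ω → ℝ) (l : ℕ) : Ω → ℝ := fun ω => (∑ i ∈ Finset.range l, L i ω) / l

/-- The standardized loss of the senior tranche with attachment point `K` of the pool of the
first `l` assets. -/
def tranche (L : ℕ → Ω → ℝ) (l : ℕ) (K : ℝ) : Ω → ℝ := fun ω => max (pool L l ω - K) 0 / (1 - K)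

/-! Properties of a mapping `Φ` from a set `D` of random variables to `ℝ`. They are used with
`D = LOne Ω` for rating criteria and with `D = LInf Ω` for risk measures. -/

section Properties

variable {D : Set (Ω → ℝ)}

/-- Law invariance [LI]. -/
def LI (P : Measure Ω) (Φ : D → ℝ) : Prop :=
  ∀ X Y : D, IdentDistrib (X : Ω → ℝ) (Y : Ω → ℝ) P P → Φ X = Φ Y

/-- `S`-law invariance [S-LI]. -/
def SLI {P : Measure Ω} {s : ℕ} (S : Scenarios P s) (Φ : D → ℝ) : Prop :=
  ∀ X Y : D, (∀ j, IdentDistrib (X : Ω → ℝ) (Y : Ω → ℝ) (S.prob j) (S.prob j)) → Φ X = Φ Y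

/-- Risk aversion consistency [RA]. -/
def RA (P : Measure Ω) (Φ : D → ℝ) : Prop :=
  ∀ X Y : D, IcxLE P X Y → Φ X ≤ Φ Y

/-- `S`-risk aversion consistency [S-RA]. -/
def SRA {P : Measure Ω} {s : ℕ} (S : Scenarios P s) (Φ : D → ℝ) : Prop :=
  ∀ X Y : D, (∀ j, IcxLE (S.prob j) X Y) → Φ X ≤ Φ Y

/-- For the sequence `L` and the attachment point `K`, the senior tranche does not get riskier
when the pool of assets gets larger. -/
def PoolingAt (Φ : D → ℝ) (L : ℕ → Ω → ℝ) (K : ℝ) : Prop :=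
  ∀ l l' : ℕ, 1 ≤ l → l ≤ l' → ∀ X Y : D,
    (X : Ω → ℝ) = tranche L l K → (Y : Ω → ℝ) = tranche L l' K → Φ Y ≤ Φ X

/-- Pooling effect consistency [PE]. -/
def PE (P : Measure Ω) (Φ : D → ℝ) : Prop :=
  ∀ L : ℕ → Ω → ℝ, (∀ i, L i ∈ LOne Ω) → CondIID P L →
    ∀ K : ℝ, 0 ≤ K → K < 1 → PoolingAt Φ L K

/-- The version [PE*] of pooling effect consistency, for the attachment point `0` only. -/
def PEStar (P : Measure Ω) (Φ : D → ℝ) : Prop :=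
  ∀ L : ℕ → Ω → ℝ, (∀ i, L i ∈ LOne Ω) → CondIID P L → PoolingAt Φ L 0

/-- `S`-pooling effect consistency [S-PE]. -/
def SPE {P : Measure Ω} {s : ℕ} (S : Scenarios P s) (Φ : D → ℝ) : Prop :=
  ∀ L : ℕ → Ω → ℝ, (∀ i, L i ∈ LOne Ω) → (∀ j, CondIID (S.prob j) L) →
    ∀ K : ℝ, 0 ≤ K → K < 1 → PoolingAt Φ L K

/-- The version [S-PE*] of `S`-pooling effect consistency, for the attachment point `0` only. -/
def SPEStar {P : Measure Ω} {s : ℕ} (S : Scenarios P s) (Φ : D → ℝ) : Prop :=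
  ∀ L : ℕ → Ω → ℝ, (∀ i, L i ∈ LOne Ω) → (∀ j, CondIID (S.prob j) L) → PoolingAt Φ L 0

/-- Quasi-convexity [QC]. -/
def QC (Φ : D → ℝ) : Prop :=
  ∀ (X Y Z : D) (c : ℝ), 0 ≤ c → c ≤ 1 →
    (Z : Ω → ℝ) = c • (X : Ω → ℝ) + (1 - c) • (Y : Ω → ℝ) → Φ Z ≤ max (Φ X) (Φ Y)

/-- Lower semi-continuity with respect to convergence in `L^∞(P)` [LS*]; the lower limit is taken
in the extended reals. -/
def LSStar (P : Measure Ω) (Φ : D → ℝ) : Prop :=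
  ∀ (X : ℕ → D) (Y : D),
    Tendsto (fun l => eLpNorm ((X l : Ω → ℝ) - (Y : Ω → ℝ)) ⊤ P) atTop (𝓝 0) →
      (Φ Y : EReal) ≤ liminf (fun l => (Φ (X l) : EReal)) atTop

end Properties

/-! The random variables in [PE] and [QC] do belong to the domains of the mappings. -/

theorem LOne_subset_LInf : LOne Ω ⊆ LInf Ω := fun X hX =>
  ⟨hX.1, 1, fun ω => abs_le.2 ⟨by linarith [(hX.2 ω).1], (hX.2 ω).2⟩⟩

theorem tranche_mem_LOne {L : ℕ → Ω → ℝ} (hL : ∀ i, L i ∈ LOne Ω) {l : ℕ} (hl : 1 ≤ l) {K : ℝ}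
    (h1 : K < 1) : tranche L l K ∈ LOne Ω := by
  have hp : Measurable (pool L l) :=
    (Finset.measurable_sum _ fun i _ => (hL i).1).div_const _
  refine ⟨((hp.sub_const K).max measurable_const).div_const _, fun ω => ?_⟩
  have hl' : (0 : ℝ) < l := by exact_mod_cast hl
  have hb : pool L l ω ≤ 1 := by
    rw [pool, div_le_one hl']
    calc ∑ i ∈ Finset.range l, L i ω ≤ ∑ _i ∈ Finset.range l, (1 : ℝ) :=
          Finset.sum_le_sum fun i _ => ((hL i).2 ω).2
      _ = l := by simp
  have hK : 0 < 1 - K := by linarith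
  refine ⟨div_nonneg (le_max_right _ _) hK.le, ?_⟩
  rw [tranche, div_le_one hK]
  exact max_le (by linarith) hK.le

theorem mix_mem_LOne {X Y : Ω → ℝ} (hX : X ∈ LOne Ω) (hY : Y ∈ LOne Ω) {c : ℝ} (h0 : 0 ≤ c)
    (h1 : c ≤ 1) : c • X + (1 - c) • Y ∈ LOne Ω := by
  refine ⟨(hX.1.const_smul c).add (hY.1.const_smul (1 - c)), fun ω => ?_⟩
  have h := hX.2 ω
  have h' := hY.2 ω
  simp only [Pi.add_apply, Pi.smul_apply, smul_eq_mul]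
  constructor <;> nlinarith

theorem mix_mem_LInf {X Y : Ω → ℝ} (hX : X ∈ LInf Ω) (hY : Y ∈ LInf Ω) (c : ℝ) :
    c • X + (1 - c) • Y ∈ LInf Ω := by
  obtain ⟨hX, A, hA⟩ := hX
  obtain ⟨hY, B, hB⟩ := hY
  refine ⟨(hX.const_smul c).add (hY.const_smul (1 - c)), |c| * A + |1 - c| * B, fun ω => ?_⟩
  simp only [Pi.add_apply, Pi.smul_apply, smul_eq_mul]
  refine (abs_add_le _ _).trans ?_
  rw [abs_mul, abs_mul]
  gcongr
  exacts [hA ω, hB ω]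

end RiskConsistency

end

open RiskConsistency

namespace RiskConsistency

variable {Ω : Type*} [MeasurableSpace Ω]

/-! ### Atomless measures -/

/-! Pooling rests on exchangeability. A conditionally iid sequence is exchangeable, and the pool of
the first `m` assets is the average of `m` cyclic windows of length `l ≤ m`, each distributed like
the pool of the first `l`. Jensen's inequality then orders the tranches in increasing convex order
(`CondIID.icxLE_tranche`), so risk aversion gives pooling consistency. With quasi-convexity and law
invariance in place of Jensen, the same average gives the version for `K = 0` (`QC.speStar`).

Risk aversion follows from quasi-convexity, semi-continuity and law invariance by a discrete
majorization argument. Inside one scenario, atomlessness cuts `X` and `Y` into ordered parts of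
equal probability. The stop-loss inequalities become, up to `ε`, weak majorization of the cut points
(`tail_sum_le_tail_sum`). Hahn-Banach and the rearrangement inequality then put `X - ε` below a
convex combination of rearrangements of a step function lying below `Y`
(`exists_average_rearrangements`). Rearrangements leave `Φ` unchanged, mixing does not raise it
above the maximum, and semi-continuity removes `ε`. Replacing `Y` by `X` one scenario at a time
finishes (`SLI.sra`).

Plain properties pass to scenarios because `P` is a mixture of the conditional measures; for
conditionally iid sequences the conditioning vectors of the scenarios are glued into one
(`Scenarios.condIID`). Conversely, the plain properties are the scenario ones for the single
scenario `Ω`. -/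

theorem Atomless.exists_le_half {P : Measure Ω} [IsFiniteMeasure P] (hP : Atomless P) {A : Set Ω}
    (hA : MeasurableSet A) (h0 : 0 < P.real A) :
    ∃ B, B ⊆ A ∧ MeasurableSet B ∧ 0 < P.real B ∧ P.real B ≤ P.real A / 2 := by
  obtain ⟨B, hBA, hB, hB0, hB1⟩ := hP A hA (ENNReal.toReal_pos_iff.1 h0).1
  have h1 : 0 < P.real B := ENNReal.toReal_pos hB0.ne' (measure_ne_top _ _)
  have h2 : P.real B < P.real A := (ENNReal.toReal_lt_toReal (by simp) (by simp)).2 hB1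
  have h3 : P.real (A \ B) = P.real A - P.real B := measureReal_sdiff hBA hB
  rcases le_total (P.real B) (P.real A / 2) with h | h
  · exact ⟨B, hBA, hB, h1, h⟩
  · exact ⟨A \ B, Set.sdiff_subset, hA.diff hB, by linarith, by linarith⟩

theorem Atomless.exists_small {P : Measure Ω} [IsFiniteMeasure P] (hP : Atomless P) {A : Set Ω}
    (hA : MeasurableSet A) (h0 : 0 < P.real A) {ε : ℝ} (hε : 0 < ε) :
    ∃ B, B ⊆ A ∧ MeasurableSet B ∧ 0 < P.real B ∧ P.real B ≤ ε := by
  have key : ∀ n : ℕ, ∃ B, B ⊆ A ∧ MeasurableSet B ∧ 0 < P.real B ∧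
      P.real B ≤ P.real A * (1 / 2) ^ n := by
    intro n
    induction n with
    | zero => exact ⟨A, subset_rfl, hA, h0, by simp⟩
    | succ n ih =>
      obtain ⟨B, h1, h2, h3, h4⟩ := ih
      obtain ⟨C, k1, k2, k3, k4⟩ := hP.exists_le_half h2 h3
      exact ⟨C, k1.trans h1, k2, k3, by rw [pow_succ]; linarith⟩
  obtain ⟨n, hn⟩ := exists_pow_lt_of_lt_one (div_pos hε h0) (by norm_num : (1 / 2 : ℝ) < 1)
  obtain ⟨B, h1, h2, h3, h4⟩ := key n
  refine ⟨B, h1, h2, h3, h4.trans ?_⟩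
  rw [lt_div_iff₀ h0] at hn
  linarith

/-- **Sierpiński's theorem**: an atomless finite measure takes every value between the measures of
two nested sets on a set in between. -/
theorem Atomless.exists_between {P : Measure Ω} [IsFiniteMeasure P] (hP : Atomless P)
    {A B : Set Ω} (hA : MeasurableSet A) (hB : MeasurableSet B) (hAB : A ⊆ B) {r : ℝ}
    (hAr : P.real A ≤ r) (hBr : r ≤ P.real B) :
    ∃ E, A ⊆ E ∧ E ⊆ B ∧ MeasurableSet E ∧ P.real E = r := by
  let T : Set (Set Ω) := {E | A ⊆ E ∧ E ⊆ B ∧ MeasurableSet E ∧ P.real E ≤ r}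
  -- Greedy choice: the next set has measure within `1 / (n + 1)` of the supremum over all
  -- admissible supersets of the current one.
  have step : ∀ (n : ℕ) (E : T), ∃ E' : T, (E : Set Ω) ⊆ E' ∧
      ∀ E'' : T, (E : Set Ω) ⊆ E'' → P.real E'' ≤ P.real E' + 1 / (n + 1) := by
    intro n E
    let V : Set ℝ := {x | ∃ F : T, (E : Set Ω) ⊆ F ∧ P.real F = x}
    have hV : V.Nonempty := ⟨_, E, subset_rfl, rfl⟩
    have hVb : BddAbove V := ⟨r, by rintro _ ⟨F, -, rfl⟩; exact F.2.2.2.2⟩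
    obtain ⟨_, ⟨F, hF, rfl⟩, hlt⟩ :=
      exists_lt_of_lt_csSup hV (sub_lt_self (sSup V) (Nat.one_div_pos_of_nat (α := ℝ) (n := n)))
    refine ⟨F, hF, fun G hG => ?_⟩
    have := le_csSup hVb ⟨G, hG, rfl⟩
    linarith
  choose succT hsucc hmax using step
  let seq : ℕ → T := fun n => Nat.rec ⟨A, subset_rfl, hAB, hA, hAr⟩ (fun n E => succT n E) n
  have hmono : Monotone fun n => (seq n).1 := monotone_nat_of_le_succ fun n => hsucc n (seq n)
  let E : Set Ω := ⋃ n, (seq n).1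
  have hE : MeasurableSet E := MeasurableSet.iUnion fun n => (seq n).2.2.2.1
  have hEr : P.real E ≤ r := by
    have h := (ENNReal.continuousAt_toReal (measure_ne_top P E)).tendsto.comp
      (tendsto_measure_iUnion_atTop (μ := P) hmono)
    exact le_of_tendsto' h fun n => (seq n).2.2.2.2
  have hAE : A ⊆ E := Set.subset_iUnion (fun n => (seq n).1) 0
  have hEB : E ⊆ B := Set.iUnion_subset fun n => (seq n).2.2.1
  refine ⟨E, hAE, hEB, hE, le_antisymm hEr ?_⟩
  -- If mass were missing, a small set `D` could be added to the union, and `1 / (n + 1) < P.real D`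
  -- would contradict the near-maximality at stage `n`.
  by_contra! hlt
  have hBE : P.real (B \ E) = P.real B - P.real E := measureReal_sdiff hEB hE
  obtain ⟨D, hD1, hD2, hD3, hD4⟩ :=
    hP.exists_small (hB.diff hE) (by linarith : 0 < P.real (B \ E)) (sub_pos.2 hlt)
  have hdisj : Disjoint E D := Set.disjoint_left.2 fun x hx hxD => (hD1 hxD).2 hx
  have hED : P.real (E ∪ D) = P.real E + P.real D := measureReal_union hdisj hD2
  have hEDT : E ∪ D ∈ T := ⟨hAE.trans Set.subset_union_left,
    Set.union_subset hEB (hD1.trans Set.sdiff_subset), hE.union hD2, by linarith⟩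
  obtain ⟨n, hn⟩ := exists_nat_one_div_lt hD3
  have h1 := hmax n (seq n) ⟨E ∪ D, hEDT⟩
    ((Set.subset_iUnion (fun n => (seq n).1) n).trans Set.subset_union_left)
  have h2 : P.real (seq (n + 1)) ≤ P.real E :=
    measureReal_mono (Set.subset_iUnion (fun n => (seq n).1) (n + 1))
  have h3 : seq (n + 1) = succT n (seq n) := rfl
  rw [h3] at h2
  simp only at h1
  linarith

/-- Cutting off a lower part of prescribed measure. -/
theorem Atomless.exists_lower_part {P : Measure Ω} [IsFiniteMeasure P] (hP : Atomless P)
    {X : Ω → ℝ} (hX : Measurable X) {B : Set Ω} (hB : MeasurableSet B) {a b : ℝ} (hab : a ≤ b)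
    (hXB : ∀ ω ∈ B, a ≤ X ω ∧ X ω ≤ b) {r : ℝ} (hr : 0 ≤ r) (hrB : r ≤ P.real B) :
    ∃ E t, E ⊆ B ∧ MeasurableSet E ∧ P.real E = r ∧ a ≤ t ∧ t ≤ b ∧
      (∀ ω ∈ E, X ω ≤ t) ∧ ∀ ω ∈ B \ E, t ≤ X ω := by
  -- The infimum of `V` is a quantile: `{X < t}` has mass at most `r` in `B` and `{X ≤ t}` at least
  -- `r`. Sierpiński's theorem then splits the level set `{X = t}`.
  let V : Set ℝ := {t | a ≤ t ∧ t ≤ b ∧ r ≤ P.real (B ∩ {ω | X ω ≤ t})}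
  have hbV : b ∈ V := ⟨hab, le_rfl, by
    rwa [show B ∩ {ω | X ω ≤ b} = B from Set.inter_eq_left.2 fun ω hω => (hXB ω hω).2]⟩
  have hVb : BddBelow V := ⟨a, fun t ht => ht.1⟩
  set t := sInf V with ht
  have hat : a ≤ t := le_csInf ⟨b, hbV⟩ fun x hx => hx.1
  have htb : t ≤ b := csInf_le hVb hbV
  have hmle : ∀ u, MeasurableSet (B ∩ {ω | X ω ≤ u}) := fun u =>
    hB.inter (measurableSet_le hX measurable_const)
  have hmlt : ∀ u, MeasurableSet (B ∩ {ω | X ω < u}) := fun u =>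
    hB.inter (measurableSet_lt hX measurable_const)
  have hup : r ≤ P.real (B ∩ {ω | X ω ≤ t}) := by
    have hEq : B ∩ {ω | X ω ≤ t} = ⋂ n : ℕ, B ∩ {ω | X ω ≤ t + 1 / (n + 1)} := by
      ext ω
      simp only [Set.mem_inter_iff, Set.mem_ofPred_eq, Set.mem_iInter]
      refine ⟨fun h n => ⟨h.1, h.2.trans (by
        have := Nat.one_div_pos_of_nat (α := ℝ) (n := n); linarith)⟩, fun h => ⟨(h 0).1, ?_⟩⟩
      refine le_of_forall_pos_le_add fun ε hε => ?_
      obtain ⟨n, hn⟩ := exists_nat_one_div_lt hε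
      have := (h n).2
      linarith
    have hanti : Antitone fun n : ℕ => B ∩ {ω | X ω ≤ t + 1 / ((n : ℝ) + 1)} := by
      intro m n hmn ω hω
      refine ⟨hω.1, le_trans (Set.mem_ofPred_eq ▸ hω.2 : X ω ≤ _) ?_⟩
      have := Nat.one_div_le_one_div (α := ℝ) hmn
      linarith
    have h := (ENNReal.continuousAt_toReal (measure_ne_top P _)).tendsto.comp
      (tendsto_measure_iInter_atTop (μ := P) (fun n => (hmle _).nullMeasurableSet) hanti
        ⟨0, measure_ne_top _ _⟩)
    rw [← hEq] at h
    refine ge_of_tendsto' h fun n => ?_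
    obtain ⟨u, hu, hut⟩ := exists_lt_of_csInf_lt ⟨b, hbV⟩
      (lt_add_of_pos_right t (Nat.one_div_pos_of_nat (α := ℝ) (n := n)))
    exact hu.2.2.trans (measureReal_mono fun ω hω => ⟨hω.1, le_trans hω.2 hut.le⟩)
  have hlow : P.real (B ∩ {ω | X ω < t}) ≤ r := by
    have hEq : B ∩ {ω | X ω < t} = ⋃ n : ℕ, B ∩ {ω | X ω ≤ t - 1 / (n + 1)} := by
      ext ω
      simp only [Set.mem_inter_iff, Set.mem_ofPred_eq, Set.mem_iUnion]
      constructor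
      · rintro ⟨h1, h2⟩
        obtain ⟨n, hn⟩ := exists_nat_one_div_lt (sub_pos.2 h2)
        exact ⟨n, h1, by linarith⟩
      · rintro ⟨n, h1, h2⟩
        have := Nat.one_div_pos_of_nat (α := ℝ) (n := n)
        exact ⟨h1, by linarith⟩
    have hmono : Monotone fun n : ℕ => B ∩ {ω | X ω ≤ t - 1 / ((n : ℝ) + 1)} := by
      intro m n hmn ω hω
      refine ⟨hω.1, le_trans (Set.mem_ofPred_eq ▸ hω.2 : X ω ≤ _) ?_⟩
      have := Nat.one_div_le_one_div (α := ℝ) hmn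
      linarith
    have h := (ENNReal.continuousAt_toReal (measure_ne_top P _)).tendsto.comp
      (tendsto_measure_iUnion_atTop (μ := P) hmono)
    rw [← hEq] at h
    refine le_of_tendsto' h fun n => ?_
    have hpos := Nat.one_div_pos_of_nat (α := ℝ) (n := n)
    -- Levels below `a` are not in `V` by definition; there the sublevel set is empty.
    by_cases ha : a ≤ t - 1 / ((n : ℝ) + 1)
    · by_contra! hlt
      have hmem : t - 1 / ((n : ℝ) + 1) ∈ V := ⟨ha, by linarith, hlt.le⟩
      have := csInf_le hVb hmem
      linarith
    · have : B ∩ {ω | X ω ≤ t - 1 / ((n : ℝ) + 1)} = ∅ := by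
        ext ω
        simp only [Set.mem_inter_iff, Set.mem_ofPred_eq, Set.mem_empty_iff_false, iff_false, not_and]
        intro h1 h2
        exact ha ((hXB ω h1).1.trans h2)
      simpa [Function.comp_def, ← one_div, this] using hr
  obtain ⟨E, h1, h2, h3, h4⟩ := hP.exists_between (hmlt t) (hmle t)
    (Set.inter_subset_inter_right _ fun ω (hω : X ω < t) => hω.le) hlow hup
  refine ⟨E, t, h2.trans Set.inter_subset_left, h3, h4, hat, htb, fun ω hω => (h2 hω).2,
    fun ω hω => ?_⟩
  by_contra! hlt
  exact hω.2 (h1 ⟨hω.1, hlt⟩)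

/-- A partition of a set into parts of equal measure, ordered along a bounded function. -/
theorem Atomless.exists_ordered_partition {P : Measure Ω} [IsFiniteMeasure P] (hP : Atomless P)
    {X : Ω → ℝ} (hX : Measurable X) {r : ℝ} (hr : 0 ≤ r) (n : ℕ) {b : ℝ} :
    ∀ {B : Set Ω} {a : ℝ}, MeasurableSet B → a ≤ b → (∀ ω ∈ B, a ≤ X ω ∧ X ω ≤ b) →
      P.real B = (n + 1) * r →
      ∃ (p : Ω → Fin (n + 1)) (c : ℕ → ℝ), Measurable p ∧ Monotone c ∧ c 0 = a ∧ c (n + 1) = b ∧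
        (∀ ω ∈ B, c (p ω) ≤ X ω ∧ X ω ≤ c (p ω + 1)) ∧ ∀ i, P.real (B ∩ p ⁻¹' {i}) = r := by
  induction n with
  | zero =>
    intro B a hB hab hXB hBr
    refine ⟨fun _ => 0, fun n => if n = 0 then a else b, measurable_const, ?_, by simp, by simp,
      fun ω hω => by simpa using hXB ω hω, fun i => ?_⟩
    · intro m n hmn
      by_cases hm : m = 0 <;> by_cases hn : n = 0 <;> simp [hm, hn, hab]
      omega
    · have hi : (fun _ : Ω => (0 : Fin (0 + 1))) ⁻¹' {i} = Set.univ := by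
        ext ω; simp [Fin.ext_iff]
      rw [hi]
      simpa using hBr
  | succ n ih =>
    intro B a hB hab hXB hBr
    have hrB : r ≤ P.real B := by
      rw [hBr]; push_cast; nlinarith [mul_nonneg (Nat.cast_nonneg (α := ℝ) n) hr]
    obtain ⟨E, t, hEB, hE, hEr, hat, htb, h1, h2⟩ :=
      hP.exists_lower_part hX hB hab hXB hr hrB
    have hBE : P.real (B \ E) = (n + 1) * r := by
      rw [measureReal_sdiff hEB hE, hBr, hEr]; push_cast; ring
    obtain ⟨p, c, hp, hc, hc0, hcn, hpc, hpr⟩ := ih (hB.diff hE) htb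
      (fun ω hω => ⟨h2 ω hω, (hXB ω hω.1).2⟩) hBE
    classical
    -- The lower part `E` gets index `0`; the parts and cut points of the rest are shifted by one.
    refine ⟨E.piecewise (fun _ => 0) (fun ω => (p ω).succ), fun k => Nat.casesOn k a c,
      Measurable.piecewise hE measurable_const ((measurable_of_finite Fin.succ).comp hp),
      ?_, rfl, by simpa using hcn, fun ω hω => ?_, fun i => ?_⟩
    · refine monotone_nat_of_le_succ fun k => ?_
      cases k with
      | zero => simpa [hc0] using hat
      | succ k => exact hc (Nat.le_succ k)
    · by_cases hωE : ω ∈ E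
      · simpa [hωE, hc0] using ⟨(hXB ω hω).1, h1 ω hωE⟩
      · simpa [hωE] using hpc ω ⟨hω, hωE⟩
    · refine Fin.cases ?_ (fun i => ?_) i
      · convert hEr using 2
        ext ω
        by_cases hωE : ω ∈ E
        · simp [hωE, hEB hωE]
        · simp [hωE]
      · convert hpr i using 2
        ext ω
        by_cases hωE : ω ∈ E
        · simp [hωE, (Fin.succ_ne_zero i).symm]
        · simp [hωE]

/-! ### Weak majorization of finite vectors -/

/-- Summation by parts: a nonnegative increasing weight preserves the sign of the tail sums. -/
theorem sum_mul_nonneg_of_tail_nonneg {n : ℕ} : ∀ {g y : Fin n → ℝ}, Monotone g → (∀ i, 0 ≤ g i) →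
    (∀ k, 0 ≤ ∑ i, if k ≤ i then y i else 0) → 0 ≤ ∑ i, g i * y i := by
  induction n with
  | zero => intros; simp
  | succ n ih =>
    intro g y hg h0 hy
    -- Taking out the smallest weight `g 0` leaves the increasing nonnegative weights `g i.succ - g
    -- 0` for the induction.
    have h1 : ∑ i, g i * y i = g 0 * ∑ i, y i + ∑ i : Fin n, (g i.succ - g 0) * y i.succ := by
      rw [Fin.sum_univ_succ, Fin.sum_univ_succ (f := y), mul_add, Finset.mul_sum, add_assoc,
        ← Finset.sum_add_distrib]
      congr 1
      exact Finset.sum_congr rfl fun i _ => by ring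
    have h2 : 0 ≤ ∑ i, y i := by simpa using hy 0
    have h3 : 0 ≤ ∑ i : Fin n, (g i.succ - g 0) * y i.succ := by
      refine ih (fun i j hij => sub_le_sub_right (hg (Fin.succ_le_succ_iff.2 hij)) _)
        (fun i => sub_nonneg.2 (hg (Fin.zero_le _))) fun k => ?_
      simpa [Fin.sum_univ_succ] using hy k.succ
    rw [h1]
    exact add_nonneg (mul_nonneg (h0 0) h2) h3

open scoped Pointwise in
/-- A vector weakly majorized by `d` is dominated by a convex combination of rearrangements
of `d`. -/
theorem exists_convexCombination_perm_ge {n : ℕ} {x d : Fin n → ℝ} (hx : Monotone x)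
    (h : ∀ k, (∑ i, if k ≤ i then x i else 0) ≤ ∑ i, if k ≤ i then d i else 0) :
    ∃ w : Equiv.Perm (Fin n) → ℝ, (∀ σ, 0 ≤ w σ) ∧ ∑ σ, w σ = 1 ∧
      ∀ i, x i ≤ ∑ σ, w σ * d (σ i) := by
  let T : (Equiv.Perm (Fin n) → ℝ) →ₗ[ℝ] Fin n → ℝ :=
    Fintype.linearCombination ℝ fun σ : Equiv.Perm (Fin n) => d ∘ σ
  have hT : ∀ w i, T w i = ∑ σ, w σ * d (σ i) := fun w i => by
    simp [T, Fintype.linearCombination_apply]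
  let H : Set (Fin n → ℝ) := T '' stdSimplex ℝ (Equiv.Perm (Fin n))
  have hH : IsCompact H :=
    (isCompact_stdSimplex ℝ _).image T.continuous_of_finiteDimensional
  -- `K` is the set of vectors dominated by a mixture of rearrangements of `d`; it is closed as the
  -- sum of a compact and a closed set, so a point outside can be strictly separated.
  let K : Set (Fin n → ℝ) := H + Set.Iic (0 : Fin n → ℝ)
  suffices hxK : x ∈ K by
    obtain ⟨_, ⟨w, hw, rfl⟩, v, hv, huv⟩ := Set.mem_add.1 hxK
    refine ⟨w, hw.1, hw.2, fun i => ?_⟩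
    rw [← huv, Pi.add_apply, hT]
    have : v i ≤ 0 := (Set.mem_Iic.1 hv) i
    linarith
  have hKc : IsClosed K := isClosed_Iic.add_left_of_isCompact hH
  have hKv : Convex ℝ K := ((convex_stdSimplex ℝ _).linear_image T).add (convex_Iic 0)
  by_contra hxK
  obtain ⟨f, u, hfK, hfx⟩ := geometric_hahn_banach_closed_point hKv hKc hxK
  let g : Fin n → ℝ := fun i => f (Pi.single i 1)
  have hf : ∀ v, f v = ∑ i, g i * v i := by
    intro v
    conv_lhs => rw [pi_eq_sum_univ' v]
    simp [g, mul_comm, map_sum]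
  have hmem : ∀ (σ : Equiv.Perm (Fin n)) (v : Fin n → ℝ), v ≤ 0 → f (d ∘ σ) + f v < u := by
    intro σ v hv
    rw [← map_add]
    exact hfK _ (Set.add_mem_add ⟨Pi.single σ 1, single_mem_stdSimplex ℝ σ, by simp [T]⟩ hv)
  -- `K` is unbounded below in each coordinate, so a negative weight would make `f` unbounded above
  -- on it.
  have hg : ∀ i, 0 ≤ g i := by
    intro i
    by_contra! hi
    obtain ⟨t, ht⟩ := exists_nat_gt ((u - f (d ∘ (1 : Equiv.Perm (Fin n)))) / (-g i))
    have h1 := hmem 1 (Pi.single i (-(t : ℝ))) (by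
      rw [Pi.single_nonpos]; simp)
    have h2 : f (Pi.single i (-(t : ℝ))) = -(t * g i) := by
      have : (Pi.single i (-(t : ℝ)) : Fin n → ℝ) = (-(t : ℝ)) • Pi.single i 1 := by
        rw [← Pi.single_smul]; simp
      rw [this, map_smul]; simp [g]
    rw [div_lt_iff₀ (by linarith)] at ht
    rw [h2] at h1
    linarith
  let τ := Tuple.sort g
  have hτ : Monotone (g ∘ τ) := Tuple.monotone_sort g
  -- With `g ∘ τ` increasing, `f x ≤ ∑ g (τ i) * x i ≤ ∑ g (τ i) * d i = f (d ∘ τ.symm) < u < f x`,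
  -- by rearrangement and summation by parts.
  have h1 : ∑ i, g (τ i) * x (τ i) ≤ ∑ i, g (τ i) * x i :=
    (hτ.monovary hx).sum_mul_comp_perm_le_sum_mul
  have h2 : 0 ≤ ∑ i, (g ∘ τ) i * (d i - x i) := by
    refine sum_mul_nonneg_of_tail_nonneg hτ (fun i => hg _) fun k => ?_
    have := sub_nonneg.2 (h k)
    rw [← Finset.sum_sub_distrib] at this
    refine this.trans_eq (Finset.sum_congr rfl fun i _ => ?_)
    split_ifs <;> simp
  have h3 := hmem τ.symm 0 le_rfl
  rw [map_zero, add_zero, hf, ← Equiv.sum_comp τ] at h3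
  rw [hf, ← Equiv.sum_comp τ] at hfx
  simp only [Function.comp_apply, Equiv.symm_apply_apply, mul_sub, Finset.sum_sub_distrib] at h2 h3
  linarith

/-! ### Domains of risk measures and rating criteria -/

/-- The features shared by the domains `LOne Ω` and `LInf Ω`. -/
structure IsSolid (D : Set (Ω → ℝ)) : Prop where
  measurable : ∀ X ∈ D, Measurable X
  LOne_subset : LOne Ω ⊆ D
  exists_bounds : ∀ X ∈ D, ∀ Y ∈ D, ∃ a b : ℝ, (∀ ω, a ≤ X ω ∧ X ω ≤ b) ∧
    (∀ ω, a ≤ Y ω ∧ Y ω ≤ b) ∧ ∀ Z : Ω → ℝ, Measurable Z → (∀ ω, a ≤ Z ω ∧ Z ω ≤ b) → Z ∈ D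

theorem isSolid_LOne : IsSolid (LOne Ω) where
  measurable _ hX := hX.1
  LOne_subset := subset_rfl
  exists_bounds _ hX _ hY := ⟨0, 1, hX.2, hY.2, fun _ hZ h => ⟨hZ, h⟩⟩

theorem isSolid_LInf : IsSolid (LInf Ω) where
  measurable _ hX := hX.1
  LOne_subset := LOne_subset_LInf
  exists_bounds := by
    rintro X ⟨-, A, hA⟩ Y ⟨-, B, hB⟩
    refine ⟨-max A B, max A B, fun ω => abs_le.1 ((hA ω).trans (le_max_left _ _)),
      fun ω => abs_le.1 ((hB ω).trans (le_max_right _ _)),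
      fun Z hZ h => ⟨hZ, max A B, fun ω => abs_le.2 (h ω)⟩⟩

theorem IsSolid.subset_LInf {D : Set (Ω → ℝ)} (hD : IsSolid D) : D ⊆ LInf Ω := by
  intro X hX
  obtain ⟨a, b, h, -, -⟩ := hD.exists_bounds X hX X hX
  refine ⟨hD.measurable X hX, max |a| |b|, fun ω => ?_⟩
  exact abs_le_max_abs_abs (h ω).1 (h ω).2

theorem IsSolid.convex {D : Set (Ω → ℝ)} (hD : IsSolid D) : Convex ℝ D := by
  intro X hX Y hY c c' hc hc' hcc
  obtain ⟨a, b, h, h', hZ⟩ := hD.exists_bounds X hX Y hY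
  refine hZ _ (((hD.measurable X hX).const_smul c).add ((hD.measurable Y hY).const_smul c'))
    fun ω => ?_
  have := convex_Icc a b (h ω) (h' ω) hc hc' hcc
  simpa using this

/-- The sublevel sets of a quasi-convex mapping are convex. -/
theorem QC.convex_sublevel {D : Set (Ω → ℝ)} {Φ : D → ℝ} (hD : IsSolid D) (hΦ : QC Φ) (M : ℝ) :
    Convex ℝ {X | ∃ h : X ∈ D, Φ ⟨X, h⟩ ≤ M} := by
  rintro X ⟨hX, hXM⟩ Y ⟨hY, hYM⟩ c c' hc hc' hcc
  obtain rfl : c' = 1 - c := by linarith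
  refine ⟨hD.convex hX hY hc hc' hcc, ?_⟩
  exact (hΦ ⟨X, hX⟩ ⟨Y, hY⟩ _ c hc (by linarith) rfl).trans (max_le hXM hYM)

theorem QC.sum_le {D : Set (Ω → ℝ)} {Φ : D → ℝ} (hD : IsSolid D) (hΦ : QC Φ) {M : ℝ} {ι : Type*}
    (t : Finset ι) {w : ι → ℝ} (hw : ∀ i ∈ t, 0 ≤ w i) (hw1 : ∑ i ∈ t, w i = 1) {F : ι → D}
    (hF : ∀ i ∈ t, Φ (F i) ≤ M) {Z : D} (hZ : (Z : Ω → ℝ) = ∑ i ∈ t, w i • (F i : Ω → ℝ)) :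
    Φ Z ≤ M := by
  obtain ⟨h, hM⟩ := (hΦ.convex_sublevel hD M).sum_mem hw hw1 fun i hi => ⟨(F i).2, hF i hi⟩
  convert hM

/-! ### Conditionally iid sequences are exchangeable -/

/-- Integrating the conditional product formula and replacing every conditional law by that of `L 0`
leaves an expression independent of `e`. -/
theorem CondIID.measureReal_box {Q : Measure Ω} [IsProbabilityMeasure Q] {L : ℕ → Ω → ℝ}
    (hL : ∀ i, Measurable (L i)) {d : ℕ} {Z : Ω → Fin d → ℝ} (hZ : Measurable Z)
    (hind : ∀ (t : Finset ℕ) (B : ℕ → Set ℝ), (∀ i, MeasurableSet (B i)) →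
      condProb Q Z (⋂ i ∈ t, L i ⁻¹' B i) =ᵐ[Q] fun ω => ∏ i ∈ t, condProb Q Z (L i ⁻¹' B i) ω)
    (hid : ∀ (i k : ℕ) (B : Set ℝ), MeasurableSet B →
      condProb Q Z (L i ⁻¹' B) =ᵐ[Q] condProb Q Z (L k ⁻¹' B))
    {n : ℕ} {e : Fin n → ℕ} (he : Function.Injective e) {B : Fin n → Set ℝ}
    (hB : ∀ k, MeasurableSet (B k)) :
    Q.real {ω | ∀ k, L (e k) ω ∈ B k} = ∫ ω, ∏ k, condProb Q Z (L 0 ⁻¹' B k) ω ∂Q := by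
  classical
  -- Indices off the range of `e` get `Set.univ`; injectivity of `e` makes the choice of preimage
  -- unambiguous.
  let B' : ℕ → Set ℝ := fun i => if h : ∃ k, e k = i then B h.choose else Set.univ
  have hB'e : ∀ k, B' (e k) = B k := fun k => by
    have h : ∃ k', e k' = e k := ⟨k, rfl⟩
    simp only [B', dif_pos h]
    rw [he h.choose_spec]
  have hB' : ∀ i, MeasurableSet (B' i) := fun i => by
    by_cases h : ∃ k, e k = i
    · simpa only [B', dif_pos h] using hB _
    · simp only [B', dif_neg h, MeasurableSet.univ]
  let t : Finset ℕ := Finset.univ.map ⟨e, he⟩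
  have hset : {ω | ∀ k, L (e k) ω ∈ B k} = ⋂ i ∈ t, L i ⁻¹' B' i := by
    ext ω
    simp [t, hB'e]
  have hmeas : MeasurableSet (⋂ i ∈ t, L i ⁻¹' B' i) :=
    Finset.measurableSet_biInter _ fun i _ => hL i (hB' i)
  have h1 : ∫ ω, condProb Q Z (⋂ i ∈ t, L i ⁻¹' B' i) ω ∂Q = Q.real (⋂ i ∈ t, L i ⁻¹' B' i) := by
    rw [condProb, integral_condExp hZ.comap_le, integral_indicator_const _ hmeas]
    simp
  rw [hset, ← h1]
  refine integral_congr_ae ((hind t B' hB').trans ?_)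
  have h2 : ∀ᵐ ω ∂Q, ∀ k, condProb Q Z (L (e k) ⁻¹' B k) ω = condProb Q Z (L 0 ⁻¹' B k) ω :=
    ae_all_iff.2 fun k => hid (e k) 0 (B k) (hB k)
  filter_upwards [h2] with ω hω
  simp [t, hB'e, hω]

theorem CondIID.identDistrib {Q : Measure Ω} [IsProbabilityMeasure Q] {L : ℕ → Ω → ℝ}
    (hL : ∀ i, Measurable (L i)) (h : CondIID Q L) {n : ℕ} {e e' : Fin n → ℕ}
    (he : Function.Injective e) (he' : Function.Injective e') :
    IdentDistrib (fun ω k => L (e k) ω) (fun ω k => L (e' k) ω) Q Q := by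
  obtain ⟨d, Z, hZ, hind, hid⟩ := h
  have hm : ∀ e : Fin n → ℕ, Measurable fun ω k => L (e k) ω :=
    fun e => measurable_pi_lambda _ fun k => hL (e k)
  refine ⟨(hm e).aemeasurable, (hm e').aemeasurable, ?_⟩
  have := Measure.isProbabilityMeasure_map (μ := Q) (hm e).aemeasurable
  refine ext_of_generate_finite _ generateFrom_pi.symm isPiSystem_pi ?_ (by
    rw [Measure.map_apply (hm e) .univ, Measure.map_apply (hm e') .univ]; rfl)
  rintro _ ⟨B, hB, rfl⟩
  have hB : ∀ k, MeasurableSet (B k) := fun k => hB k (Set.mem_univ k)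
  have hmB : MeasurableSet (Set.univ.pi B) := MeasurableSet.univ_pi hB
  have hpre : ∀ e : Fin n → ℕ, (fun ω k => L (e k) ω) ⁻¹' Set.univ.pi B =
      {ω | ∀ k, L (e k) ω ∈ B k} := fun e => by ext ω; simp
  rw [Measure.map_apply (hm e) hmB, Measure.map_apply (hm e') hmB, hpre, hpre,
    ← measureReal_eq_measureReal_iff, measureReal_box hL hZ hind hid he hB,
    measureReal_box hL hZ hind hid he' hB]

/-- The average of `l` cyclically consecutive members of the pool of the first `m` assets. -/
noncomputable def shiftPool (L : ℕ → Ω → ℝ) (l m i : ℕ) : Ω → ℝ :=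
  fun ω => (∑ k ∈ Finset.range l, L ((i + k) % m) ω) / l

theorem pool_mem_LOne {L : ℕ → Ω → ℝ} (hL : ∀ i, L i ∈ LOne Ω) {l : ℕ} (hl : 1 ≤ l) :
    pool L l ∈ LOne Ω := by
  convert tranche_mem_LOne hL hl zero_lt_one using 1
  ext ω
  have : 0 ≤ pool L l ω :=
    div_nonneg (Finset.sum_nonneg fun i _ => ((hL i).2 ω).1) (Nat.cast_nonneg _)
  simp [tranche, this]

theorem tranche_zero {L : ℕ → Ω → ℝ} (hL : ∀ i, L i ∈ LOne Ω) {l : ℕ} (hl : 1 ≤ l) :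
    tranche L l 0 = pool L l := by
  ext ω
  simp [tranche, ((pool_mem_LOne hL hl).2 ω).1]

theorem shiftPool_mem_LOne {L : ℕ → Ω → ℝ} (hL : ∀ i, L i ∈ LOne Ω) {l : ℕ} (hl : 1 ≤ l)
    (m i : ℕ) : shiftPool L l m i ∈ LOne Ω :=
  pool_mem_LOne (L := fun k => L ((i + k) % m)) (fun _ => hL _) hl

/-- Over all `m` cyclic windows, each asset is counted `l` times in total, because `i ↦ (i + k) % m`
permutes the indices for fixed `k`. -/
theorem pool_eq_average_shiftPool (L : ℕ → Ω → ℝ) {l m : ℕ} (hl : 1 ≤ l) (ω : Ω) :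
    pool L m ω = ∑ i ∈ Finset.range m, (m : ℝ)⁻¹ * shiftPool L l m i ω := by
  have hshift : ∀ k, ∑ i ∈ Finset.range m, L ((i + k) % m) ω = ∑ i ∈ Finset.range m, L i ω := by
    intro k
    conv_rhs => rw [← Nat.image_Ico_mod k m, Finset.sum_image (Nat.mod_injOn_Ico k m),
      Finset.sum_Ico_eq_sum_range]
    simp [add_comm]
  have hl' : (l : ℝ) ≠ 0 := by exact_mod_cast (by omega : l ≠ 0)
  rw [← Finset.mul_sum]
  simp only [shiftPool, pool]
  rw [← Finset.sum_div, Finset.sum_comm, Finset.sum_congr rfl fun k _ => hshift k]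
  simp only [Finset.sum_const, Finset.card_range, nsmul_eq_mul]
  rw [mul_div_cancel_left₀ _ hl']
  ring

/-- As `l ≤ m`, a window has no repeated index, so exchangeability applies. -/
theorem CondIID.identDistrib_shiftPool {Q : Measure Ω} [IsProbabilityMeasure Q] {L : ℕ → Ω → ℝ}
    (hL : ∀ i, Measurable (L i)) (h : CondIID Q L) {l m : ℕ} (hlm : l ≤ m) (i : ℕ) :
    IdentDistrib (shiftPool L l m i) (pool L l) Q Q := by
  have he : Function.Injective fun k : Fin l => (i + k) % m := by
    intro k k' hkk
    have := Nat.mod_injOn_Ico i m (x₁ := i + k) (x₂ := i + k')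
      (by simp; omega) (by simp; omega) hkk
    exact Fin.ext (by omega)
  have hu : Measurable fun v : Fin l → ℝ => (∑ k, v k) / (l : ℝ) :=
    (Finset.measurable_sum _ fun k _ => measurable_pi_apply k).div_const _
  have := (h.identDistrib hL he Fin.val_injective).comp hu
  convert this using 1
  · ext ω
    simp [shiftPool, Finset.sum_range]
  · ext ω
    simp [pool, Finset.sum_range]

/-! ### Increasing convex functions of bounded random variables -/

/-- Ensures that the integrals in the increasing convex order of bounded variables are never the
default value `0` of a non-integrable function. -/
theorem integrable_comp_of_mem_LInf {Q : Measure Ω} [IsFiniteMeasure Q] {X : Ω → ℝ}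
    (hX : X ∈ LInf Ω) {φ : ℝ → ℝ} (hφ : Monotone φ) : Integrable (fun ω => φ (X ω)) Q := by
  obtain ⟨hm, C, hC⟩ := hX
  refine Integrable.of_bound (hφ.measurable.comp hm).aestronglyMeasurable (max |φ (-C)| |φ C|)
    (ae_of_all _ fun ω => ?_)
  have := abs_le.1 (hC ω)
  exact abs_le_max_abs_abs (hφ this.1) (hφ this.2)

theorem _root_.ProbabilityTheory.IdentDistrib.icxLE {Q : Measure Ω} {X Y : Ω → ℝ} (h : IdentDistrib X Y Q Q) :
    IcxLE Q X Y := fun _ hφ _ => (h.comp hφ.measurable).integral_eq.le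

theorem convexOn_tranche {K : ℝ} (hK : K < 1) :
    ConvexOn ℝ Set.univ fun x : ℝ => max (x - K) 0 / (1 - K) := by
  have h1 : ConvexOn ℝ Set.univ fun x : ℝ => x - K := by
    refine ((convexOn_id (𝕜 := ℝ) (convex_univ (E := ℝ))).add_const (-K)).congr fun x _ => ?_
    simp [sub_eq_add_neg]
  have h2 := (h1.sup (convexOn_const 0 convex_univ)).smul
    (inv_nonneg.2 (by linarith : 0 ≤ 1 - K))
  refine h2.congr fun x _ => ?_
  simp [div_eq_inv_mul]

theorem monotone_tranche {K : ℝ} (hK : K < 1) :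
    Monotone fun x : ℝ => max (x - K) 0 / (1 - K) := fun x y hxy =>
  div_le_div_of_nonneg_right (max_le_max_right 0 (by linarith)) (by linarith)

/-- The tranche payoff is increasing and convex, hence so is its composition with `φ`; Jensen's
inequality applies to the average of windows. -/
theorem CondIID.icxLE_tranche {Q : Measure Ω} [IsProbabilityMeasure Q] {L : ℕ → Ω → ℝ}
    (hL : ∀ i, L i ∈ LOne Ω) (h : CondIID Q L) {l m : ℕ} (hl : 1 ≤ l) (hlm : l ≤ m) {K : ℝ}
    (hK : K < 1) : IcxLE Q (tranche L m K) (tranche L l K) := by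
  intro φ hφ hφc
  let ψ : ℝ → ℝ := fun x => φ (max (x - K) 0 / (1 - K))
  have hψ : Monotone ψ := hφ.comp (monotone_tranche hK)
  have hψc : ConvexOn ℝ Set.univ ψ :=
    ⟨convex_univ, fun _ _ _ _ _ _ ha hb hab =>
      (hφ ((convexOn_tranche hK).2 trivial trivial ha hb hab)).trans
        (hφc.2 trivial trivial ha hb hab)⟩
  have hφi : ∀ {X : Ω → ℝ}, X ∈ LOne Ω → Integrable (fun ω => ψ (X ω)) Q :=
    fun hX => integrable_comp_of_mem_LInf (LOne_subset_LInf hX) hψ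
  have hm : (0 : ℝ) < m := by exact_mod_cast (by omega : 0 < m)
  have hw : ∑ _i ∈ Finset.range m, (m : ℝ)⁻¹ = 1 := by simp [hm.ne']
  calc ∫ ω, ψ (pool L m ω) ∂Q
      ≤ ∫ ω, ∑ i ∈ Finset.range m, (m : ℝ)⁻¹ * ψ (shiftPool L l m i ω) ∂Q := by
        refine integral_mono (hφi (pool_mem_LOne hL (hl.trans hlm)))
          (integrable_finsetSum _ fun i _ =>
            (hφi (shiftPool_mem_LOne hL hl m i)).const_mul _) fun ω => ?_
        simp only [pool_eq_average_shiftPool L hl ω]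
        exact hψc.map_sum_le (fun i _ => (inv_pos.2 hm).le) hw fun i _ => Set.mem_univ _
    _ = ∑ i ∈ Finset.range m, (m : ℝ)⁻¹ * ∫ ω, ψ (pool L l ω) ∂Q := by
        rw [integral_finsetSum _ fun i _ => (hφi (shiftPool_mem_LOne hL hl m i)).const_mul _]
        refine Finset.sum_congr rfl fun i _ => ?_
        rw [integral_const_mul]
        congr 1
        exact ((h.identDistrib_shiftPool (fun i => (hL i).1) hlm i).comp hψ.measurable).integral_eq
    _ = ∫ ω, ψ (pool L l ω) ∂Q := by rw [← Finset.sum_mul, hw, one_mul]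

/-! ### Consequences of risk aversion and of quasi-convexity -/

instance Scenarios.isProbabilityMeasure_prob {P : Measure Ω} [IsProbabilityMeasure P] {s : ℕ}
    (S : Scenarios P s) (j : Fin s) : IsProbabilityMeasure (S.prob j) :=
  cond_isProbabilityMeasure (S.prob_pos j).ne'

section

variable {P : Measure Ω} [IsProbabilityMeasure P] {s : ℕ} {S : Scenarios P s} {D : Set (Ω → ℝ)}
  {Φ : D → ℝ}

theorem SRA.sli (h : SRA S Φ) : SLI S Φ := fun X Y hXY =>
  le_antisymm (h X Y fun j => (hXY j).icxLE) (h Y X fun j => (hXY j).symm.icxLE)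

theorem SRA.spe (h : SRA S Φ) : SPE S Φ := by
  intro L hL hiid K _ hK l m hl hlm X Y hX hY
  refine h Y X fun j => ?_
  rw [hX, hY]
  exact (hiid j).icxLE_tranche hL hl hlm hK

/-- At `K = 0` the tranche is the pool itself, so the larger pool is a mixture of windows on which
`Φ` takes its value at the smaller pool. -/
theorem QC.speStar (hD : IsSolid D) (hQC : QC Φ) (hLI : SLI S Φ) : SPEStar S Φ := by
  intro L hL hiid l m hl hlm X Y hX hY
  rw [tranche_zero hL hl] at hX
  rw [tranche_zero hL (hl.trans hlm)] at hY
  have hm : (0 : ℝ) < m := by exact_mod_cast (by omega : 0 < m)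
  refine hQC.sum_le hD (Finset.range m) (w := fun _ => (m : ℝ)⁻¹)
    (F := fun i => ⟨shiftPool L l m i, hD.LOne_subset (shiftPool_mem_LOne hL hl m i)⟩)
    (fun i _ => (inv_pos.2 hm).le) (by simp [hm.ne']) (fun i _ => (hLI _ _ fun j => ?_).le) ?_
  · rw [hX]
    exact (hiid j).identDistrib_shiftPool (fun i => (hL i).1) hlm i
  · rw [hY]
    ext ω
    simpa using pool_eq_average_shiftPool L hl ω

end

/-! ### From the scenarios to the whole space -/

theorem Scenarios.measure_eq_sum {P : Measure Ω} [IsProbabilityMeasure P] {s : ℕ}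
    (S : Scenarios P s) : P = ∑ j, P (S.event j) • S.prob j := by
  ext A hA
  have hA' : A = ⋃ j, S.event j ∩ A := by rw [← Set.iUnion_inter, S.cover, Set.univ_inter]
  rw [Measure.finsetSum_apply]
  simp only [Measure.smul_apply, smul_eq_mul, Scenarios.prob]
  conv_lhs => rw [hA']
  rw [measure_iUnion (fun i j hij => (S.disjoint hij).mono Set.inter_subset_left
    Set.inter_subset_left) fun j => (S.measurable j).inter hA, tsum_fintype]
  exact Finset.sum_congr rfl fun j _ => by rw [mul_comm, cond_mul_eq_inter (S.measurable j)]

theorem Scenarios.ae_of_forall_prob {P : Measure Ω} [IsProbabilityMeasure P] {s : ℕ}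
    (S : Scenarios P s) {p : Ω → Prop} (h : ∀ j, ∀ᵐ ω ∂S.prob j, p ω) : ∀ᵐ ω ∂P, p ω := by
  rw [ae_iff, S.measure_eq_sum, Measure.finsetSum_apply]
  refine Finset.sum_eq_zero fun j _ => ?_
  rw [Measure.smul_apply, ae_iff.1 (h j), smul_zero]

theorem Scenarios.identDistrib {P : Measure Ω} [IsProbabilityMeasure P] {s : ℕ}
    (S : Scenarios P s) {X Y : Ω → ℝ} (hX : Measurable X) (hY : Measurable Y)
    (h : ∀ j, IdentDistrib X Y (S.prob j) (S.prob j)) : IdentDistrib X Y P P := by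
  refine ⟨hX.aemeasurable, hY.aemeasurable, ?_⟩
  ext B hB
  rw [Measure.map_apply hX hB, Measure.map_apply hY hB, S.measure_eq_sum,
    Measure.finsetSum_apply, Measure.finsetSum_apply]
  refine Finset.sum_congr rfl fun j _ => ?_
  rw [Measure.smul_apply, Measure.smul_apply, (h j).measure_mem_eq hB]

theorem Scenarios.icxLE {P : Measure Ω} [IsProbabilityMeasure P] {s : ℕ}
    (S : Scenarios P s) {X Y : Ω → ℝ} (hX : X ∈ LInf Ω) (hY : Y ∈ LInf Ω)
    (h : ∀ j, IcxLE (S.prob j) X Y) : IcxLE P X Y := by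
  intro φ hφ hφc
  have hφi : ∀ {W : Ω → ℝ}, W ∈ LInf Ω → ∫ ω, φ (W ω) ∂P =
      ∑ j, (P (S.event j)).toReal * ∫ ω, φ (W ω) ∂S.prob j := by
    intro W hW
    conv_lhs => rw [S.measure_eq_sum]
    rw [integral_finsetSum_measure fun j _ =>
      (integrable_comp_of_mem_LInf hW hφ).smul_measure (measure_ne_top _ _)]
    simp only [integral_smul_measure, smul_eq_mul]
  rw [hφi hX, hφi hY]
  exact Finset.sum_le_sum fun j _ => mul_le_mul_of_nonneg_left (h j φ hφ hφc) ENNReal.toReal_nonneg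

/-- On an event `S` that is a function of `Z`, and on which the vectors `Z` and `Z'` are functions
of each other, the conditional probability given `Z` is the conditional probability given `Z'` under
the measure conditioned on `S`. -/
theorem condProb_ae_eq_cond {P : Measure Ω} [IsProbabilityMeasure P] {S : Set Ω}
    (hS : MeasurableSet S) (hS0 : P S ≠ 0) {d d' : ℕ} {Z : Ω → Fin d → ℝ} {Z' : Ω → Fin d' → ℝ}
    (hZ : Measurable Z) (hZ' : Measurable Z')
    (hSZ : MeasurableSet[MeasurableSpace.comap Z inferInstance] S)
    {u : (Fin d → ℝ) → Fin d' → ℝ} (hu : Measurable u) (huZ : ∀ ω ∈ S, u (Z ω) = Z' ω)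
    {v : (Fin d' → ℝ) → Fin d → ℝ} (hv : Measurable v) (hvZ : ∀ ω ∈ S, v (Z' ω) = Z ω)
    {A : Set Ω} (hA : MeasurableSet A) :
    condProb P Z A =ᵐ[cond P S] condProb (cond P S) Z' A := by
  have : IsProbabilityMeasure (cond P S) := cond_isProbabilityMeasure hS0
  set f : Ω → ℝ := A.indicator fun _ => (1 : ℝ) with hf
  have hfm : Measurable f := measurable_const.indicator hA
  have hfi : ∀ (μ : Measure Ω) [IsFiniteMeasure μ], Integrable f μ := fun μ _ =>
    (integrable_const (1 : ℝ)).indicator hA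
  set h : Ω → ℝ := condProb (cond P S) Z' A with hh
  have hhm : StronglyMeasurable[MeasurableSpace.comap Z' inferInstance] h :=
    stronglyMeasurable_condExp
  have hcond : ∀ (g : Ω → ℝ) (E : Set Ω), MeasurableSet E →
      ∫ ω in E, g ω ∂cond P S = (P S).toReal⁻¹ * ∫ ω in E ∩ S, g ω ∂P := by
    intro g E hE
    rw [ProbabilityTheory.cond, Measure.restrict_smul, integral_smul_measure, Measure.restrict_restrict hE]
    simp
  have hPS : (P S).toReal ≠ 0 := (ENNReal.toReal_pos hS0 (measure_ne_top _ _)).ne'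
  have hhi : IntegrableOn h S P := by
    have h1 : Integrable h (cond P S) := integrable_condExp
    rw [ProbabilityTheory.cond, integrable_smul_measure (by simp) (by simpa using hS0)] at h1
    exact h1
  -- Checked through the defining property: on `S`, events of `Z` are events of `Z'`, and `h` is a
  -- function of `Z' = u (Z)`. Afterwards the indicator of `S` is pulled out.
  have key : S.indicator h =ᵐ[P] P[S.indicator f | MeasurableSpace.comap Z inferInstance] := by
    refine ae_eq_condExp_of_forall_setIntegral_eq hZ.comap_le ((hfi P).indicator hS)
      (fun E _ _ => ((integrable_indicator_iff hS).2 hhi).integrableOn) ?_ ?_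
    · rintro _ ⟨E, hE, rfl⟩ -
      have hinter : Z ⁻¹' E ∩ S = (v ∘ Z') ⁻¹' E ∩ S := by
        ext ω
        simp only [Set.mem_inter_iff, Set.mem_preimage, Function.comp_apply, and_congr_left_iff]
        intro hω
        rw [hvZ ω hω]
      have hF : MeasurableSet ((v ∘ Z') ⁻¹' E) := (hv.comp hZ') hE
      have h1 : ∫ ω in (v ∘ Z') ⁻¹' E, h ω ∂cond P S = ∫ ω in (v ∘ Z') ⁻¹' E, f ω ∂cond P S :=
        setIntegral_condExp hZ'.comap_le (hfi _) ⟨v ⁻¹' E, hv hE, rfl⟩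
      rw [hcond _ _ hF, hcond _ _ hF] at h1
      rw [setIntegral_indicator hS, setIntegral_indicator hS, hinter]
      exact mul_left_cancel₀ (inv_ne_zero hPS) h1
    · refine Measurable.aestronglyMeasurable ?_
      intro C hC
      obtain ⟨F, hF, hFC⟩ := hhm.measurable hC
      have hpre : S.indicator h ⁻¹' C = S ∩ (Z ⁻¹' (u ⁻¹' F)) ∪ Sᶜ ∩ {_ω | (0 : ℝ) ∈ C} := by
        ext ω
        by_cases hω : ω ∈ S
        · have : h ω ∈ C ↔ Z' ω ∈ F := by
            rw [← Set.mem_preimage, ← hFC, Set.mem_preimage]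
          simp [hω, this, huZ ω hω]
        · simp [hω]
      rw [hpre]
      exact (hSZ.inter ⟨_, hu hF, rfl⟩).union (hSZ.compl.inter (MeasurableSet.const _))
  have h2 := key.trans (condExp_indicator (hfi P) hSZ)
  filter_upwards [cond_absolutelyContinuous.ae_le h2, ae_cond_mem hS] with ω hω hωS
  rw [Set.indicator_of_mem hωS, Set.indicator_of_mem hωS] at hω
  exact hω.symm

/-- A sequence that is conditionally iid in every scenario is conditionally iid. -/
theorem Scenarios.condIID {P : Measure Ω} [IsProbabilityMeasure P] {s : ℕ}
    (S : Scenarios P s) {L : ℕ → Ω → ℝ} (hL : ∀ i, Measurable (L i))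
    (h : ∀ j, CondIID (S.prob j) L) : CondIID P L := by
  classical
  choose d Z hZ hind hid using h
  -- The glued vector has, for each scenario, its indicator (coordinate `none`) and the conditioning
  -- vector of that scenario, set to `0` outside it. It thus determines the scenario, and within it
  -- carries the same information as `Z j`.
  let ι := Σ j : Fin s, Option (Fin (d j))
  let e : ι ≃ Fin (Fintype.card ι) := Fintype.equivFin ι
  let W : ι → Ω → ℝ := fun i => (S.event i.1).indicator fun ω => i.2.elim 1 (Z i.1 ω)
  have hW : ∀ i, Measurable (W i) := by
    rintro ⟨j, k⟩
    refine Measurable.indicator ?_ (S.measurable j)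
    cases k with
    | none => exact measurable_const
    | some k => exact (measurable_pi_apply k).comp (hZ j)
  let Y : Ω → Fin (Fintype.card ι) → ℝ := fun ω i => W (e.symm i) ω
  have hY : Measurable Y := measurable_pi_lambda _ fun i => hW (e.symm i)
  have hYe : ∀ i ω, Y ω (e i) = W i ω := fun i ω =>
    congrArg (fun i => W i ω) (e.symm_apply_apply i)
  have hloc : ∀ j {A : Set Ω}, MeasurableSet A →
      condProb P Y A =ᵐ[S.prob j] condProb (S.prob j) (Z j) A := by
    intro j A hA
    let v : (Fin (d j) → ℝ) → Fin (Fintype.card ι) → ℝ := fun z i =>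
      if hi : (e.symm i).1 = j then (e.symm i).2.elim 1 fun k => z (hi ▸ k) else 0
    refine condProb_ae_eq_cond (S.measurable j) (S.prob_pos j).ne' hY (hZ j)
      (u := fun y k => y (e ⟨j, some k⟩)) (v := v) ?_ ?_ ?_ ?_ ?_ hA
    · refine ⟨(fun y => y (e ⟨j, none⟩)) ⁻¹' {1},
        measurable_pi_apply _ (measurableSet_singleton _), ?_⟩
      ext ω
      by_cases hω : ω ∈ S.event j <;> simp [hYe, W, hω]
    · exact measurable_pi_lambda _ fun k => measurable_pi_apply _
    · intro ω hω
      ext k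
      simp [hYe, W, hω]
    · refine measurable_pi_lambda _ fun i => ?_
      simp only [v]
      rcases e.symm i with ⟨j', k⟩
      by_cases hj : j' = j
      · subst hj
        cases k with
        | none => simp
        | some k => simpa using measurable_pi_apply k
      · simp [hj]
    · intro ω hω
      ext i
      simp only [v, Y]
      rcases e.symm i with ⟨j', k⟩
      by_cases hj : j' = j
      · subst hj
        simp [W, hω]
      · have : ω ∉ S.event j' := fun h => Set.disjoint_left.1 (S.disjoint hj) h hω
        simp [W, hj, this]
  refine ⟨_, Y, hY, fun t B hB => S.ae_of_forall_prob fun j => ?_,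
    fun i k B hB => S.ae_of_forall_prob fun j => ?_⟩
  · have h1 : ∀ᵐ ω ∂S.prob j, ∀ i, condProb P Y (L i ⁻¹' B i) ω =
        condProb (S.prob j) (Z j) (L i ⁻¹' B i) ω := ae_all_iff.2 fun i => hloc j (hL i (hB i))
    filter_upwards [h1, hind j t B hB, hloc j (Finset.measurableSet_biInter t fun i _ => hL i (hB i))]
      with ω h1 h2 h3
    rw [h3, h2]
    exact Finset.prod_congr rfl fun i _ => (h1 i).symm
  · exact (hloc j (hL i hB)).trans ((hid j i k B hB).trans (hloc j (hL k hB)).symm)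

/-! ### The properties and their scenario-based versions -/

section

variable {P : Measure Ω} [IsProbabilityMeasure P] {s : ℕ} {S : Scenarios P s} {D : Set (Ω → ℝ)}
  {Φ : D → ℝ}

theorem LI.sli (hD : IsSolid D) (h : LI P Φ) : SLI S Φ := fun X Y hXY =>
  h X Y (S.identDistrib (hD.measurable X X.2) (hD.measurable Y Y.2) hXY)

theorem RA.sra (hD : IsSolid D) (h : RA P Φ) : SRA S Φ := fun X Y hXY =>
  h X Y (S.icxLE (hD.subset_LInf X.2) (hD.subset_LInf Y.2) hXY)

theorem PE.spe (h : PE P Φ) : SPE S Φ := fun L hL hiid =>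
  h L hL (S.condIID (fun i => (hL i).1) hiid)

theorem PEStar.speStar (h : PEStar P Φ) : SPEStar S Φ := fun L hL hiid =>
  h L hL (S.condIID (fun i => (hL i).1) hiid)

theorem Scenarios.IsWhole.prob_eq (hS : S.IsWhole) (j : Fin s) : S.prob j = P := by
  rw [Scenarios.prob, hS.2 j, cond_univ]

theorem SLI.li (hS : S.IsWhole) (h : SLI S Φ) : LI P Φ := fun X Y hXY =>
  h X Y fun j => by rwa [hS.prob_eq j]

theorem SRA.ra (hS : S.IsWhole) (h : SRA S Φ) : RA P Φ := fun X Y hXY =>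
  h X Y fun j => by rwa [hS.prob_eq j]

theorem SPE.pe (hS : S.IsWhole) (h : SPE S Φ) : PE P Φ := fun L hL hiid =>
  h L hL fun j => by rwa [hS.prob_eq j]

theorem SPEStar.peStar (hS : S.IsWhole) (h : SPEStar S Φ) : PEStar P Φ := fun L hL hiid =>
  h L hL fun j => by rwa [hS.prob_eq j]

variable (P) in
/-- The collection that consists of the single scenario `Ω`. -/
def Scenarios.whole : Scenarios P 1 where
  event _ := Set.univ
  pos := one_pos
  measurable _ := .univ
  disjoint _ _ hij := (hij (Subsingleton.elim _ _)).elim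
  prob_pos _ := by simp
  cover := Set.iUnion_const _

variable (P) in
theorem Scenarios.isWhole_whole : (Scenarios.whole P).IsWhole := ⟨rfl, fun _ => rfl⟩

end

/-! ### Uniformly distributed indices -/

theorem integral_comp_of_uniform {Q : Measure Ω} [IsProbabilityMeasure Q] {n : ℕ} {p : Ω → Fin n}
    (hp : Measurable p) {r : ℝ} (hpr : ∀ i, Q.real (p ⁻¹' {i}) = r) (g : Fin n → ℝ) :
    ∫ ω, g (p ω) ∂Q = r * ∑ i, g i := by
  have := Measure.isProbabilityMeasure_map (μ := Q) hp.aemeasurable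
  rw [← integral_map hp.aemeasurable (measurable_of_finite g).aestronglyMeasurable,
    integral_fintype .of_finite, Finset.mul_sum]
  refine Finset.sum_congr rfl fun i _ => ?_
  rw [map_measureReal_apply hp (measurableSet_singleton i), hpr, smul_eq_mul]

theorem identDistrib_of_uniform {Q : Measure Ω} [IsProbabilityMeasure Q] {n : ℕ} {p q : Ω → Fin n}
    (hp : Measurable p) (hq : Measurable q) {r : ℝ} (hpr : ∀ i, Q.real (p ⁻¹' {i}) = r)
    (hqr : ∀ i, Q.real (q ⁻¹' {i}) = r) (σ : Equiv.Perm (Fin n)) :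
    IdentDistrib (fun ω => σ (p ω)) q Q Q := by
  have hσ : Measurable fun ω => σ (p ω) := (measurable_of_finite σ).comp hp
  refine ⟨hσ.aemeasurable, hq.aemeasurable, Measure.ext_of_singleton fun i => ?_⟩
  rw [Measure.map_apply hσ (measurableSet_singleton i),
    Measure.map_apply hq (measurableSet_singleton i), ← measureReal_eq_measureReal_iff, hqr,
    ← hpr (σ.symm i)]
  congr 1
  ext ω
  simp [Equiv.eq_symm_apply]

/-! ### Approximation by averages of rearrangements -/

/-- The lower and upper cut points of two ordered partitions satisfy a weak majorization. -/
theorem tail_sum_le_tail_sum {n : ℕ} {c e : ℕ → ℝ} (hc : Monotone c) (he : Monotone e)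
    {a b M ε η : ℝ} (hε : 0 < ε) (hMb : M ≤ b) (hc0 : c 0 = a) (hcn : c n = M)
    (he0 : e 0 = a) (hen : e n = b)
    (hloss : ∀ t, ∑ i : Fin n, max (c i - t) 0 ≤ ∑ i : Fin n, max (e (i + 1) - t) 0)
    (hη : n * η ≤ ∑ i : Fin n, max (e (i + 1) - (M - ε)) 0)
    (hn : 2 * (b - a) * (b - (M - ε)) ≤ n * η * ε) (k : Fin n) :
    (∑ i : Fin n, if k ≤ i then c (i + 1) - ε else 0) ≤ ∑ i : Fin n, if k ≤ i then e i else 0 := by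
  simp only [← Finset.sum_filter]
  set F : Finset (Fin n) := Finset.univ.filter fun i => k ≤ i with hF
  have hkF : ∀ i ∈ F, (k : ℕ) ≤ i := fun i hi => (Finset.mem_filter.1 hi).2
  -- If `e k` is at least `M - ε`, the comparison holds term by term, since `c (i + 1) ≤ M`.
  rcases le_or_gt (M - ε) (e k) with hk | hk
  · refine Finset.sum_le_sum fun i hi => ?_
    have h1 : c (i + 1) ≤ M := hcn ▸ hc i.2
    have h2 := he (hkF i hi)
    linarith
  have hupper : ∀ t, e k ≤ t → ∑ i : Fin n, max (e (i + 1) - t) 0 =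
      ∑ i ∈ F, max (e (i + 1) - t) 0 := by
    intro t ht
    refine (Finset.sum_subset (Finset.subset_univ F) fun i _ hi => ?_).symm
    have hik : (i : ℕ) + 1 ≤ k := by
      have : ¬ k ≤ i := fun h => hi (Finset.mem_filter.2 ⟨Finset.mem_univ _, h⟩)
      exact not_le.1 this
    exact max_eq_right (by linarith [he hik])
  -- The total excess over `M - ε`, at least `n * η`, is carried by `F`, each index contributing at
  -- most `b - (M - ε)`; hence `F` is large.
  have hcard : 2 * (b - a) ≤ F.card * ε := by
    have h1 : n * η ≤ F.card * (b - (M - ε)) := by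
      refine (hη.trans_eq (hupper _ hk.le)).trans ?_
      rw [← nsmul_eq_mul]
      refine Finset.sum_le_card_nsmul _ _ _ fun i _ => max_le ?_ (by linarith)
      have : e (i + 1) ≤ b := hen ▸ he i.2
      linarith
    have h2 : 2 * (b - a) * (b - (M - ε)) ≤ F.card * ε * (b - (M - ε)) := by nlinarith
    exact le_of_mul_le_mul_right h2 (by linarith)
  have hmain : ∑ i ∈ F, c i ≤ ∑ i ∈ F, e (i + 1) := by
    have h1 : ∑ i ∈ F, (c i - e k) ≤ ∑ i : Fin n, max (c i - e k) 0 :=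
      (Finset.sum_le_sum fun i _ => le_max_left _ _).trans
        (Finset.sum_le_sum_of_subset_of_nonneg (Finset.subset_univ F) fun i _ _ => le_max_right _ _)
    have h2 : ∑ i ∈ F, max (e (i + 1) - e k) 0 = ∑ i ∈ F, (e (i + 1) - e k) :=
      Finset.sum_congr rfl fun i hi =>
        max_eq_left (sub_nonneg.2 (he ((hkF i hi).trans (Nat.le_succ _))))
    have h3 := h1.trans ((hloss (e k)).trans_eq ((hupper _ le_rfl).trans h2))
    rw [Finset.sum_sub_distrib, Finset.sum_sub_distrib] at h3
    linarith
  -- Exchanging lower and upper cut points costs at most `b - a` for each family by telescoping; the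
  -- gain `F.card * ε` pays for both.
  have htel : ∀ {f : ℕ → ℝ}, Monotone f → ∑ i ∈ F, f (i + 1) - ∑ i ∈ F, f i ≤ f n - f 0 := by
    intro f hf
    rw [← Finset.sum_sub_distrib]
    refine (Finset.sum_le_sum_of_subset_of_nonneg (Finset.subset_univ F)
      fun i _ _ => sub_nonneg.2 (hf (Nat.le_succ i))).trans_eq ?_
    rw [Fin.sum_univ_eq_sum_range (fun i => f (i + 1) - f i), Finset.sum_range_sub]
  have h1 := htel hc
  have h2 := htel he
  rw [Finset.sum_sub_distrib, Finset.sum_const, nsmul_eq_mul]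
  linarith

/-- The indices `p` and `q` are equidistributed, so each `e (σ (p ω))` has the law of `e (q ω)`, a
step function below `Y`. The hypothesis `hpos` lets a fine enough partition absorb the
discretization error into `ε`. -/
theorem exists_average_rearrangements {P : Measure Ω} [IsProbabilityMeasure P] (hP : Atomless P)
    {S : Set Ω} (hS : MeasurableSet S) (hS0 : P S ≠ 0) {X Y : Ω → ℝ} (hX : Measurable X)
    (hY : Measurable Y) {a b M ε : ℝ} (hXab : ∀ ω, a ≤ X ω ∧ X ω ≤ b)
    (hYab : ∀ ω, a ≤ Y ω ∧ Y ω ≤ b) (hXM : ∀ ω ∈ S, X ω ≤ M) (haM : a ≤ M) (hMb : M ≤ b)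
    (hε : 0 < ε) (hpos : 0 < ∫ ω, max (X ω - (M - ε)) 0 ∂P[|S]) (hXY : IcxLE P[|S] X Y) :
    ∃ (n : ℕ) (p q : Ω → Fin n) (e : Fin n → ℝ) (w : Equiv.Perm (Fin n) → ℝ) (r : ℝ),
      Measurable p ∧ Measurable q ∧ (∀ i, P[|S].real (p ⁻¹' {i}) = r) ∧
      (∀ i, P[|S].real (q ⁻¹' {i}) = r) ∧ (∀ i, a ≤ e i ∧ e i ≤ b) ∧
      (∀ σ, 0 ≤ w σ) ∧ ∑ σ, w σ = 1 ∧ (∀ ω ∈ S, e (q ω) ≤ Y ω) ∧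
      ∀ ω ∈ S, X ω - ε ≤ ∑ σ, w σ * e (σ (p ω)) := by
  have : IsProbabilityMeasure P[|S] := cond_isProbabilityMeasure hS0
  set η := ∫ ω, max (X ω - (M - ε)) 0 ∂P[|S] with hη
  -- This size is what the counting argument in `tail_sum_le_tail_sum` requires.
  obtain ⟨N, hN⟩ := exists_nat_ge (2 * (b - a) * (b - (M - ε)) / (η * ε))
  rw [div_le_iff₀ (mul_pos hpos hε)] at hN
  have hr : 0 ≤ P.real S / (N + 1) := by positivity
  have hPS : P.real S = (N + 1) * (P.real S / (N + 1)) := by field_simp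
  obtain ⟨p, c, hp, hc, hc0, hcn, hpc, hpr⟩ := hP.exists_ordered_partition hX hr N hS haM
    (fun ω hω => ⟨(hXab ω).1, hXM ω hω⟩) hPS
  obtain ⟨q, e, hq, he, he0, hen, hqe, hqr⟩ := hP.exists_ordered_partition hY hr N hS
    (haM.trans hMb) (fun ω _ => hYab ω) hPS
  have hPS0 : P.real S ≠ 0 := (ENNReal.toReal_pos hS0 (measure_ne_top _ _)).ne'
  have huni : ∀ {u : Ω → Fin (N + 1)}, (∀ i, P.real (S ∩ u ⁻¹' {i}) = P.real S / (N + 1)) →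
      ∀ i, P[|S].real (u ⁻¹' {i}) = ((N : ℝ) + 1)⁻¹ := by
    intro u hu i
    rw [measureReal_def, cond_apply hS, ENNReal.toReal_mul, ENNReal.toReal_inv, ← measureReal_def,
      ← measureReal_def, hu i]
    field_simp
  have hinv : (0 : ℝ) < ((N : ℝ) + 1)⁻¹ := by positivity
  have hφ : ∀ t : ℝ, Monotone fun x : ℝ => max (x - t) 0 := fun t x y hxy =>
    max_le_max_right 0 (by linarith)
  have hφc : ∀ t : ℝ, ConvexOn ℝ Set.univ fun x : ℝ => max (x - t) 0 := fun t => by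
    refine (((convexOn_id (𝕜 := ℝ) (convex_univ (E := ℝ))).add_const (-t)).sup
      (convexOn_const 0 convex_univ)).congr fun x _ => ?_
    simp [sub_eq_add_neg]
  have hφi : ∀ {W : Ω → ℝ} (t : ℝ), Measurable W → (∀ ω, a ≤ W ω ∧ W ω ≤ b) →
      Integrable (fun ω => max (W ω - t) 0) P[|S] := fun {W} t hW h =>
    integrable_comp_of_mem_LInf ⟨hW, max |a| |b|, fun ω => abs_le_max_abs_abs (h ω).1 (h ω).2⟩
      (hφ t)
  have hintf : ∀ {u : Ω → Fin (N + 1)} (g : Fin (N + 1) → ℝ), Measurable u →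
      Integrable (fun ω => g (u ω)) P[|S] := fun {u} g hu =>
    Integrable.of_bound ((measurable_of_finite g).comp hu).aestronglyMeasurable (∑ i, |g i|)
      (ae_of_all _ fun ω => Finset.single_le_sum (f := fun i => |g i|) (fun i _ => abs_nonneg _)
        (Finset.mem_univ (u ω)))
  have hlow : ∀ t, ((N : ℝ) + 1)⁻¹ * ∑ i : Fin (N + 1), max (c i - t) 0 ≤
      ∫ ω, max (X ω - t) 0 ∂P[|S] := by
    intro t
    rw [← integral_comp_of_uniform hp (huni hpr) fun i => max (c i - t) 0]
    refine integral_mono_ae (hintf (fun i => max (c i - t) 0) hp) (hφi t hX hXab) ?_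
    filter_upwards [ae_cond_mem hS] with ω hω
    exact hφ t (hpc ω hω).1
  have hupp : ∀ t, ∫ ω, max (Y ω - t) 0 ∂P[|S] ≤
      ((N : ℝ) + 1)⁻¹ * ∑ i : Fin (N + 1), max (e (i + 1) - t) 0 := by
    intro t
    rw [← integral_comp_of_uniform hq (huni hqr) fun i => max (e (i + 1) - t) 0]
    refine integral_mono_ae (hφi t hY hYab) (hintf (fun i => max (e (i + 1) - t) 0) hq) ?_
    filter_upwards [ae_cond_mem hS] with ω hω
    exact hφ t (hqe ω hω).2
  have hloss : ∀ t, ∫ ω, max (X ω - t) 0 ∂P[|S] ≤ ∫ ω, max (Y ω - t) 0 ∂P[|S] := fun t =>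
    hXY _ (hφ t) (hφc t)
  have htail := tail_sum_le_tail_sum (n := N + 1) (η := η) hc he hε hMb hc0 hcn he0 hen
    (fun t => le_of_mul_le_mul_left ((hlow t).trans ((hloss t).trans (hupp t))) hinv)
    (by
      have := (hloss (M - ε)).trans (hupp (M - ε))
      rwa [← hη, inv_mul_eq_div, le_div_iff₀ (by positivity), mul_comm, ← Nat.cast_succ] at this)
    (by push_cast; nlinarith [mul_pos hpos hε])
  obtain ⟨w, hw, hw1, hwx⟩ := exists_convexCombination_perm_ge
    (x := fun i : Fin (N + 1) => c (i + 1) - ε) (d := fun i => e i)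
    (fun i j hij => sub_le_sub_right (hc (Nat.succ_le_succ hij)) _) htail
  refine ⟨N + 1, p, q, fun i => e i, w, _, hp, hq, huni hpr, huni hqr,
    fun i => ⟨he0 ▸ he (Nat.zero_le _), hen ▸ he i.2.le⟩, hw, hw1, fun ω hω => (hqe ω hω).1,
    fun ω hω => ?_⟩
  exact (sub_le_sub_right (hpc ω hω).2 ε).trans (hwx (p ω))

/-! ### From quasi-convexity and semi-continuity to risk aversion -/

theorem LSStar.le_of_forall_pos {P : Measure Ω} {D : Set (Ω → ℝ)} {Φ : D → ℝ}
    (hLS : LSStar P Φ) {X : D} {m : ℝ}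
    (h : ∀ ε > 0, ∃ Z : D, (∀ ω, |(Z : Ω → ℝ) ω - (X : Ω → ℝ) ω| ≤ ε) ∧ Φ Z ≤ m) : Φ X ≤ m := by
  choose Z hZ hZm using fun l : ℕ => h (1 / (l + 1)) Nat.one_div_pos_of_nat
  have hlim : Tendsto (fun l => eLpNorm ((Z l : Ω → ℝ) - (X : Ω → ℝ)) ⊤ P) atTop (𝓝 0) := by
    have h0 : Tendsto (fun l : ℕ => ENNReal.ofReal (1 / ((l : ℝ) + 1))) atTop (𝓝 0) := by
      simpa using ENNReal.tendsto_ofReal tendsto_one_div_add_atTop_nhds_zero_nat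
    refine tendsto_of_tendsto_of_tendsto_of_le_of_le tendsto_const_nhds h0 (fun _ => bot_le)
      fun l => ?_
    rw [eLpNorm_exponent_top]
    exact eLpNormEssSup_le_of_ae_bound (ae_of_all _ fun ω => hZ l ω)
  have h1 : liminf (fun l => (Φ (Z l) : EReal)) atTop ≤ liminf (fun _ : ℕ => (m : EReal)) atTop :=
    liminf_le_liminf (Eventually.of_forall fun l => EReal.coe_le_coe_iff.2 (hZm l))
  rw [liminf_const] at h1
  exact EReal.coe_le_coe_iff.1 ((hLS Z X hlim).trans h1)

theorem IcxLE.congr_ae {Q : Measure Ω} {X X' Y Y' : Ω → ℝ} (h : IcxLE Q X Y) (hX : X' =ᵐ[Q] X)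
    (hY : Y' =ᵐ[Q] Y) : IcxLE Q X' Y' := by
  intro φ hφ hφc
  calc ∫ ω, φ (X' ω) ∂Q = ∫ ω, φ (X ω) ∂Q := integral_congr_ae (hX.fun_comp φ)
    _ ≤ ∫ ω, φ (Y ω) ∂Q := h φ hφ hφc
    _ = ∫ ω, φ (Y' ω) ∂Q := (integral_congr_ae (hY.fun_comp φ)).symm

section

variable {P : Measure Ω} [IsProbabilityMeasure P] {s : ℕ} {S : Scenarios P s} {D : Set (Ω → ℝ)}
  {Φ : D → ℝ}

theorem Scenarios.eqOn_of_ne (S : Scenarios P s) {i j : Fin s} (hij : i ≠ j) {X Y : Ω → ℝ}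
    (h : ∀ ω, ω ∉ S.event j → X ω = Y ω) : X =ᵐ[S.prob i] Y := by
  filter_upwards [ae_cond_mem (S.measurable i)] with ω hω
  exact h ω fun hj => Set.disjoint_left.1 (S.disjoint hij) hω hj

/-- The case of random variables that are ordered in one scenario, where the smaller one is bounded
by its essential supremum, and coincide in the others. -/
theorem SLI.le_of_icxLE_of_bounded (hP : Atomless P) (hD : IsSolid D) (hΦ : Monotone Φ)
    (hQC : QC Φ) (hLS : LSStar P Φ) (hLI : SLI S Φ) {X Y : D} {j : Fin s}
    (hoff : ∀ ω, ω ∉ S.event j → (X : Ω → ℝ) ω = (Y : Ω → ℝ) ω)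
    (hXY : IcxLE (S.prob j) X Y) {a b M : ℝ} (hXab : ∀ ω, a ≤ (X : Ω → ℝ) ω ∧ (X : Ω → ℝ) ω ≤ b)
    (hYab : ∀ ω, a ≤ (Y : Ω → ℝ) ω ∧ (Y : Ω → ℝ) ω ≤ b)
    (hab : ∀ Z : Ω → ℝ, Measurable Z → (∀ ω, a ≤ Z ω ∧ Z ω ≤ b) → Z ∈ D)
    (hXM : ∀ ω ∈ S.event j, (X : Ω → ℝ) ω ≤ M) (haM : a ≤ M) (hMb : M ≤ b)
    (hpos : ∀ ε > 0, 0 < ∫ ω, max ((X : Ω → ℝ) ω - (M - ε)) 0 ∂S.prob j) : Φ X ≤ Φ Y := by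
  classical
  have hXm := hD.measurable X X.2
  have hYm := hD.measurable Y Y.2
  have hSm := S.measurable j
  refine hLS.le_of_forall_pos fun ε hε => ?_
  obtain ⟨n, p, q, e, w, r, hp, hq, hpr, hqr, he, hw, hw1, heY, hXe⟩ :=
    exists_average_rearrangements hP hSm (S.prob_pos j).ne' hXm hYm hXab hYab hXM haM hMb hε
      (hpos ε hε) hXY
  have hmem : ∀ {u : Ω → Fin n}, Measurable u → (S.event j).piecewise (fun ω => e (u ω)) Y ∈ D :=
    fun {u} hu => hab _ (Measurable.piecewise hSm ((measurable_of_finite e).comp hu) hYm)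
      fun ω => by by_cases hω : ω ∈ S.event j <;> simp [hω, he, hYab]
  have hσm : ∀ σ : Equiv.Perm (Fin n), Measurable fun ω => σ (p ω) := fun σ =>
    (measurable_of_finite σ).comp hp
  -- On the scenario `Y` is replaced by its lower step function, or by a rearrangement of it;
  -- elsewhere `Y` is kept, so the laws agree in every scenario.
  let Y' : D := ⟨_, hmem hq⟩
  let F : Equiv.Perm (Fin n) → D := fun σ => ⟨_, hmem (hσm σ)⟩
  have hY' : Φ Y' ≤ Φ Y := hΦ fun ω => by
    by_cases hω : ω ∈ S.event j <;> simp [Y', hω, heY]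
  have hF : ∀ σ, Φ (F σ) ≤ Φ Y := by
    intro σ
    refine (hLI _ _ fun i => ?_).trans_le hY'
    by_cases hij : i = j
    · subst hij
      have hin : ∀ {u : Ω → Fin n},
          (S.event i).piecewise (fun ω => e (u ω)) Y =ᵐ[S.prob i] fun ω => e (u ω) := by
        intro u
        filter_upwards [ae_cond_mem hSm] with ω hω
        simp [hω]
      have : IsProbabilityMeasure P[|S.event i] := S.isProbabilityMeasure_prob i
      have h1 := (identDistrib_of_uniform hp hq hpr hqr σ).comp (measurable_of_finite e)
      exact ((IdentDistrib.of_ae_eq (hD.measurable _ (F σ).2).aemeasurable hin).trans h1).trans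
        (IdentDistrib.of_ae_eq (hD.measurable _ Y'.2).aemeasurable hin).symm
    · refine IdentDistrib.of_ae_eq (hD.measurable _ (F σ).2).aemeasurable
        (S.eqOn_of_ne hij fun ω hω => ?_)
      simp [F, Y', hω]
  let W : D := ⟨∑ σ, w σ • (F σ : Ω → ℝ), hD.convex.sum_mem (fun σ _ => hw σ) hw1
    fun σ _ => (F σ).2⟩
  have hW : Φ W ≤ Φ Y :=
    hQC.sum_le hD Finset.univ (fun σ _ => hw σ) hw1 (fun σ _ => hF σ) rfl
  -- Truncation at `a` keeps `Z` in the domain; it does not harm the domination, as the averages of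
  -- the `e i` are at least `a`.
  let Z : D := ⟨(S.event j).piecewise (fun ω => max ((X : Ω → ℝ) ω - ε) a) X, hab _
    (Measurable.piecewise hSm ((hXm.sub_const ε).max measurable_const) hXm) fun ω => by
      by_cases hω : ω ∈ S.event j
      · have := hXab ω
        simp only [Set.piecewise_eq_of_mem _ _ _ hω]
        exact ⟨le_max_right _ _, max_le (by linarith) (by linarith)⟩
      · simpa [hω] using hXab ω⟩
  refine ⟨Z, fun ω => ?_, (hΦ fun ω => ?_).trans hW⟩
  · by_cases hω : ω ∈ S.event j
    · have := (hXab ω).1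
      simp only [Z, Set.piecewise_eq_of_mem _ _ _ hω]
      rw [abs_le]
      constructor
      · linarith [le_max_left ((X : Ω → ℝ) ω - ε) a]
      · have : max ((X : Ω → ℝ) ω - ε) a ≤ (X : Ω → ℝ) ω := max_le (by linarith) this
        linarith
    · simp [Z, hω, hε.le]
  · by_cases hω : ω ∈ S.event j
    · have h1 : (∑ σ, w σ • (F σ : Ω → ℝ)) ω = ∑ σ, w σ * e (σ (p ω)) := by
        simp [F, hω]
      have h2 : a ≤ ∑ σ, w σ * e (σ (p ω)) := by
        calc a = ∑ σ, w σ * a := by rw [← Finset.sum_mul, hw1, one_mul]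
          _ ≤ _ := Finset.sum_le_sum fun σ _ => mul_le_mul_of_nonneg_left (he _).1 (hw σ)
      simp only [Z, W, Set.piecewise_eq_of_mem _ _ _ hω, h1]
      exact max_le (hXe ω hω) h2
    · have h1 : (∑ σ, w σ • (F σ : Ω → ℝ)) ω = (Y : Ω → ℝ) ω := by
        simp [F, hω, ← Finset.sum_mul, hw1]
      simp only [Z, W, Set.piecewise_eq_of_notMem _ _ _ hω, h1, hoff ω hω, le_refl]

/-- The case of random variables that are ordered in one scenario and coincide in the others. -/
theorem SLI.le_of_icxLE (hP : Atomless P) (hD : IsSolid D) (hΦ : Monotone Φ)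
    (hQC : QC Φ) (hLS : LSStar P Φ) (hLI : SLI S Φ) {X Y : D} {j : Fin s}
    (hoff : ∀ ω, ω ∉ S.event j → (X : Ω → ℝ) ω = (Y : Ω → ℝ) ω)
    (hXY : IcxLE (S.prob j) X Y) : Φ X ≤ Φ Y := by
  classical
  obtain ⟨a, b, hXab, hYab, hab⟩ := hD.exists_bounds X X.2 Y Y.2
  have hXm := hD.measurable X X.2
  have hSm := S.measurable j
  have hle : IsBoundedUnder (· ≤ ·) (ae (S.prob j)) (X : Ω → ℝ) :=
    isBoundedUnder_of ⟨b, fun ω => (hXab ω).2⟩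
  have hge : IsBoundedUnder (· ≥ ·) (ae (S.prob j)) (X : Ω → ℝ) :=
    isBoundedUnder_of ⟨a, fun ω => (hXab ω).1⟩
  set M := essSup (X : Ω → ℝ) (S.prob j) with hM
  have hXM : ∀ᵐ ω ∂S.prob j, (X : Ω → ℝ) ω ≤ M := ae_le_essSup hle
  have hMle : ∀ m, (∀ᵐ ω ∂S.prob j, (X : Ω → ℝ) ω ≤ m) → M ≤ m := fun m hm =>
    essSup_le_of_ae_le m hm hge.isCoboundedUnder_le
  have hMb : M ≤ b := hMle b (ae_of_all _ fun ω => (hXab ω).2)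
  have haM : a ≤ M := by
    obtain ⟨ω, hω⟩ := hXM.exists
    exact (hXab ω).1.trans hω
  -- Truncating at the essential supremum turns the almost sure bound by `M` into a pointwise one
  -- without changing the law in any scenario.
  have hX'ab : ∀ ω, a ≤ (S.event j).piecewise (fun ω => min ((X : Ω → ℝ) ω) M) X ω ∧
      (S.event j).piecewise (fun ω => min ((X : Ω → ℝ) ω) M) X ω ≤ b := fun ω => by
    by_cases hω : ω ∈ S.event j
    · simp only [Set.piecewise_eq_of_mem _ _ _ hω]
      exact ⟨le_min (hXab ω).1 haM, (min_le_left _ _).trans (hXab ω).2⟩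
    · simpa [hω] using hXab ω
  let X' : D := ⟨_, hab _ (Measurable.piecewise hSm (hXm.min measurable_const) hXm) hX'ab⟩
  have hX'X : ∀ i, (X' : Ω → ℝ) =ᵐ[S.prob i] X := by
    intro i
    by_cases hij : i = j
    · subst hij
      filter_upwards [hXM, ae_cond_mem hSm] with ω h1 h2
      simp [X', h1, h2]
    · exact S.eqOn_of_ne hij fun ω hω => by simp [X', hω]
  have hΦX : Φ X' = Φ X := hLI _ _ fun i =>
    IdentDistrib.of_ae_eq (hD.measurable _ X'.2).aemeasurable (hX'X i)
  rw [← hΦX]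
  refine hLI.le_of_icxLE_of_bounded hP hD hΦ hQC hLS (j := j) (M := M)
    (fun ω hω => by simpa [X', hω] using hoff ω hω) (hXY.congr_ae (hX'X j) EventuallyEq.rfl)
    hX'ab hYab hab (fun ω hω => by simp [X', hω]) haM hMb fun ε hε => ?_
  have hφi : Integrable (fun ω => max ((X' : Ω → ℝ) ω - (M - ε)) 0) (S.prob j) :=
    integrable_comp_of_mem_LInf (hD.subset_LInf X'.2) (φ := fun x => max (x - (M - ε)) 0)
      fun x y hxy => max_le_max_right 0 (by linarith)
  -- A vanishing integral would make `M - ε` an essential upper bound.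
  refine lt_of_le_of_ne (integral_nonneg fun ω => le_max_right _ _) fun h0 => ?_
  have h1 := (integral_eq_zero_iff_of_nonneg (fun ω => le_max_right _ _) hφi).1 h0.symm
  have h2 : M ≤ M - ε := hMle _ (by
    filter_upwards [h1, hX'X j] with ω h1 h2
    have h3 : max ((X' : Ω → ℝ) ω - (M - ε)) 0 = 0 := h1
    rw [h2] at h3
    linarith [max_eq_right_iff.1 h3])
  linarith

theorem SLI.sra (hP : Atomless P) (hD : IsSolid D) (hΦ : Monotone Φ)
    (hQC : QC Φ) (hLS : LSStar P Φ) (hLI : SLI S Φ) : SRA S Φ := by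
  classical
  intro X Y hXY
  obtain ⟨a, b, hXab, hYab, hab⟩ := hD.exists_bounds X X.2 Y Y.2
  have hXm := hD.measurable X X.2
  have hYm := hD.measurable Y Y.2
  let U : Finset (Fin s) → Set Ω := fun T => ⋃ j ∈ T, S.event j
  have hU : ∀ T, MeasurableSet (U T) := fun T =>
    Finset.measurableSet_biUnion T fun j _ => S.measurable j
  -- `H T` interpolates between `Y` and `X`; adding one index to `T` alters it in one scenario only.
  let H : Finset (Fin s) → D := fun T => ⟨(U T).piecewise X Y,
    hab _ (Measurable.piecewise (hU T) hXm hYm) fun ω => by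
      by_cases hω : ω ∈ U T <;> simp [hω, hXab, hYab]⟩
  have key : ∀ T, Φ (H T) ≤ Φ Y := by
    intro T
    induction T using Finset.induction_on with
    | empty =>
      refine le_of_eq (congrArg Φ (Subtype.ext (funext fun ω => ?_)))
      have hω : ω ∉ U ∅ := by simp [U]
      simp [H, hω]
    | insert j T hj ih =>
      have hUins : ∀ ω, ω ∈ U (insert j T) ↔ ω ∈ S.event j ∨ ω ∈ U T := fun ω => by
        simp [U]
      have hdisj : ∀ ω ∈ S.event j, ω ∉ U T := fun ω hω hT => by
        obtain ⟨i, hi, hωi⟩ := Set.mem_iUnion₂.1 hT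
        exact Set.disjoint_left.1 (S.disjoint (ne_of_mem_of_not_mem hi hj)) hωi hω
      refine (hLI.le_of_icxLE hP hD hΦ hQC hLS (j := j) (fun ω hω => ?_)
        ((hXY j).congr_ae ?_ ?_)).trans ih
      · by_cases hT : ω ∈ U T <;> simp [H, hUins, hω, hT, Set.piecewise]
      · filter_upwards [ae_cond_mem (S.measurable j)] with ω hω
        simp [H, hUins, hω, Set.piecewise]
      · filter_upwards [ae_cond_mem (S.measurable j)] with ω hω
        simp [H, hdisj ω hω]
  have hX : H Finset.univ = X := by
    refine Subtype.ext (funext fun ω => ?_)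
    have hω : ω ∈ U Finset.univ := by simpa [U] using Set.mem_iUnion.1 (S.cover ▸ Set.mem_univ ω)
    simp [H, hω]
  exact hX ▸ key Finset.univ

/-- All implications between the consistency properties of a monotone mapping. -/
theorem consistency_implications (hP : Atomless P) (S : Scenarios P s) (hD : IsSolid D)
    (hΦ : Monotone Φ) :
    (LI P Φ → SLI S Φ) ∧ (RA P Φ → SRA S Φ) ∧ (PE P Φ → SPE S Φ) ∧ (PEStar P Φ → SPEStar S Φ) ∧
    (S.IsWhole → (LI P Φ ↔ SLI S Φ) ∧ (RA P Φ ↔ SRA S Φ) ∧ (PE P Φ ↔ SPE S Φ) ∧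
      (PEStar P Φ ↔ SPEStar S Φ)) ∧
    (RA P Φ → LI P Φ ∧ PE P Φ) ∧
    (SRA S Φ → SLI S Φ ∧ SPE S Φ) ∧
    (QC Φ → LSStar P Φ → LI P Φ → RA P Φ) ∧
    (QC Φ → LSStar P Φ → SLI S Φ → SRA S Φ) ∧
    (QC Φ → LI P Φ → PEStar P Φ) ∧
    (QC Φ → SLI S Φ → SPEStar S Φ) := by
  -- The claims without scenarios are obtained from those for the trivial collection.
  have hw := Scenarios.isWhole_whole P
  refine ⟨LI.sli hD, RA.sra hD, PE.spe, PEStar.speStar,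
    fun h => ⟨⟨LI.sli hD, SLI.li h⟩, ⟨RA.sra hD, SRA.ra h⟩, ⟨PE.spe, SPE.pe h⟩,
      ⟨PEStar.speStar, SPEStar.peStar h⟩⟩, fun h => ?_, fun h => ⟨h.sli, h.spe⟩,
    fun hQC hLS h => ((h.sli hD).sra hP hD hΦ hQC hLS).ra hw,
    fun hQC hLS h => h.sra hP hD hΦ hQC hLS,
    fun hQC h => (hQC.speStar hD (h.sli hD)).peStar hw, fun hQC h => hQC.speStar hD h⟩
  have h' : SRA (Scenarios.whole P) Φ := h.sra hD
  exact ⟨h'.sli.li hw, h'.spe.pe hw⟩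

end

end RiskConsistency

theorem theorem2 {Ω : Type*} [MeasurableSpace Ω] (P : Measure Ω)
    [IsProbabilityMeasure P] (hP : Atomless P)
    {s : ℕ} (S : Scenarios P s) :
    (∀ ρ : RiskMeasure Ω,
      (LI P ρ.toFun → SLI S ρ.toFun) ∧
      (RA P ρ.toFun → SRA S ρ.toFun) ∧
      (PE P ρ.toFun → SPE S ρ.toFun) ∧
      (PEStar P ρ.toFun → SPEStar S ρ.toFun) ∧
      (S.IsWhole → (LI P ρ.toFun ↔ SLI S ρ.toFun) ∧
          (RA P ρ.toFun ↔ SRA S ρ.toFun) ∧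
          (PE P ρ.toFun ↔ SPE S ρ.toFun) ∧
          (PEStar P ρ.toFun ↔ SPEStar S ρ.toFun)) ∧
      (RA P ρ.toFun → LI P ρ.toFun ∧ PE P ρ.toFun) ∧
      (SRA S ρ.toFun → SLI S ρ.toFun ∧ SPE S ρ.toFun) ∧
      (QC ρ.toFun → LSStar P ρ.toFun → LI P ρ.toFun → RA P ρ.toFun) ∧
      (QC ρ.toFun → LSStar P ρ.toFun → SLI S ρ.toFun → SRA S ρ.toFun) ∧
      (QC ρ.toFun → LI P ρ.toFun → PEStar P ρ.toFun) ∧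
      (QC ρ.toFun → SLI S ρ.toFun → SPEStar S ρ.toFun)) ∧
    (∀ n : ℕ, 2 ≤ n → ∀ I : RatingCriterion Ω n,
      (LI P I.toReal → SLI S I.toReal) ∧
      (RA P I.toReal → SRA S I.toReal) ∧
      (PE P I.toReal → SPE S I.toReal) ∧
      (PEStar P I.toReal → SPEStar S I.toReal) ∧
      (S.IsWhole → (LI P I.toReal ↔ SLI S I.toReal) ∧
          (RA P I.toReal ↔ SRA S I.toReal) ∧
          (PE P I.toReal ↔ SPE S I.toReal) ∧
          (PEStar P I.toReal ↔ SPEStar S I.toReal)) ∧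
      (RA P I.toReal → LI P I.toReal ∧ PE P I.toReal) ∧
      (SRA S I.toReal → SLI S I.toReal ∧ SPE S I.toReal) ∧
      (QC I.toReal → LSStar P I.toReal → LI P I.toReal → RA P I.toReal) ∧
      (QC I.toReal → LSStar P I.toReal → SLI S I.toReal → SRA S I.toReal) ∧
      (QC I.toReal → LI P I.toReal → PEStar P I.toReal) ∧
      (QC I.toReal → SLI S I.toReal → SPEStar S I.toReal)) := by
  exact ⟨fun ρ => consistency_implications hP S isSolid_LInf ρ.mono, fun _ _ I =>
    consistency_implications hP S isSolid_LOne fun _ _ h => Nat.cast_le.2 (I.mono h)⟩
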